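/- **Setting.** Let $I\subseteq\mathbb R$ be an interval of nonzero length, with endpoints $-\infty\le a<b\le\infty$ (each endpoint may or may not belong to $I$), and let $\mathbf w=(w_0,w_1,\dots)$ be a sequence of Borel-measurable, strictly positive functions $I\to\mathbb R$, each bounded on every compact subset of $I$. Let $k,n$ be integers with $1\le k\le n+1$. Let $\mathcal{LD}$ be the set of functions $I\to\mathbb R$ that are right-continuous on $I\setminus\{b\}$ and, if $b\in I$, left-continuous at $b$. For a positive Borel function $w$ on $I$, let $\mathcal L_w$ be the set of Borel functions $f\colon I\to\mathbb R$ for which there is a Borel function $D_wf\colon I\to\mathbb R$ such that $(D_wf)/w\in\mathcal{LD}$, $D_wf$ is Lebesgue integrable between any two points of $I$, and $f(x)=f(z)+\int_z^x (D_wf)(u)\,du$ for all $x,z\in I$; the function $D_wf$ is then unique. Let $\mathcal L^0$ be the set of all Borel functions $I\to\mathbb R$ and $f^{(0)}:=f/w_0$; recursively, let $\mathcal L^{j+1}:=\{f\in\mathcal L^{j}: f^{(j)}\in\mathcal L_{w_{j+1}}\}$ and $f^{(j+1)}:=(D_{w_{j+1}}f^{(j)})/w_{j+1}$ for $f\in\mathcal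 L^{j+1}$. A $\mathbf w$-polynomial of degree $\le m$ is a function $p\in\mathcal L^{m+1}$ with $p^{(m+1)}=0$; the set of these is denoted $\mathsf P^{\le m}$. Let $$\mathcal F_+^{k:n}:=\{f\in\mathcal L^n:\ f^{(j)}\text{ is nondecreasing for each } j=k-1,\dots,n\},\qquad \mathsf P_+^{k:n}:=\mathsf P^{\le n}\cap\mathcal F_+^{k:n}.$$ For $t\in I$, let $p_{t;n,n}:=w_n$ and $p_{t;j,n}(x):=w_j(x)\int_t^x p_{t;j+1,n}(u)\,du$ for $0\le j<n$, and let $p^+_{t;0,n}(x):=p_{t;0,n}(x)\,\mathbf 1\{x\ge t\}$, for all $x\in I$. For a nonnegative (not necessarily finite) Borel measure $\nu$ on $I$ and a Borel function $f\colon I\to\mathbb R$, the integral $\nu(f)$ exists if $\nu(f_+)<\infty$ or $\nu(f_-)<\infty$, where $f_\pm:=\max(\pm f,0)$, and then $\nu(f):=\nu(f_+)-\nu(f_-)\in[-\infty,\infty]$. Any relation involving $\nu(f)$ includes the assertion that $\nu(f)$ exists. For a set $\mathcal G$ of Borel functions on $I$, let $\mathcal N_+(\mathcal G)$ be the set of all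 nonnegative Borel measures $\nu$ on $I$ such that $\nu(f)>-\infty$ for all $f\in\mathcal G$, and let the dual cone of $\mathcal G$ be $$\hat{\mathcal G}:=\{(\nu_1,\nu_2)\in\mathcal N_+(\mathcal G)\times\mathcal N_+(\mathcal G):\ \nu_1(f)\ge\nu_2(f)\ \text{for all } f\in\mathcal G\}.$$ **Theorem.** Let $\mathcal G$ be any set of functions with $$\mathsf P_+^{k:n}\cup\{p^+_{t;0,n}: t\in I\}\subseteq\mathcal G\subseteq\mathcal F_+^{k:n},$$ and let $(\nu_1,\nu_2)\in\mathcal N_+(\mathcal G)\times\mathcal N_+(\mathcal G)$. Then $(\nu_1,\nu_2)\in\hat{\mathcal G}$ if and only if all of the following conditions hold: (i) $\nu_1(p)=\nu_2(p)\in\mathbb R$ for all $p\in\mathsf P^{\le k-1}$; (ii) $\nu_1(p)\ge\nu_2(p)$ for all $p\in\mathsf P_+^{k:n}$; (iii) $\nu_1(p^+_{t;0,n})\ge\nu_2(p^+_{t;0,n})$ for all $t\in I$. -/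

import Mathlib

open MeasureTheory Set Filter Topology
open scoped ENNReal

noncomputable section

namespace GaugedCone

variable {I : Set ℝ}

/-- Extension by zero to `ℝ` of a function on `I`; it is only ever integrated between points
of `I`. -/
def ext (g : I → ℝ) (u : ℝ) : ℝ :=
  open Classical in if h : u ∈ I then g ⟨u, h⟩ else 0

/-- Bounded on every compact subset of `I`. -/
def LocallyBounded (f : I → ℝ) : Prop :=
  ∀ K : Set I, IsCompact K → ∃ C : ℝ, ∀ x ∈ K, |f x| ≤ C

/-- A sequence `(w₀, w₁, …)` of gauge functions on `I`: Borel measurable, (strictly) positive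
and locally bounded. -/
structure IsGauge (w : ℕ → I → ℝ) : Prop where
  measurable : ∀ j, Measurable (w j)
  pos : ∀ j x, 0 < w j x
  locallyBounded : ∀ j, LocallyBounded (w j)

/-- The functions on `I` that are right-continuous at every point of `I` except at the maximum
`b` of `I` (if there is one), and left-continuous at `b` (if `b ∈ I`). -/
def LD : Set (I → ℝ) :=
  {f | (∀ x : I, ¬ IsMax x → ContinuousWithinAt f (Ici x) x) ∧
       (∀ x : I, IsMax x → ContinuousWithinAt f (Iic x) x)}

/-- `g = D_w f`: the function `g` is Borel, `g / w` is in `LD`, and `f` is an indefinite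
Lebesgue integral of `g` on `I`. -/
structure HasGenDeriv (w f g : I → ℝ) : Prop where
  measurable : Measurable g
  mem_LD : g / w ∈ (LD : Set (I → ℝ))
  intervalIntegrable : ∀ z x : I, IntervalIntegrable (ext g) volume z x
  eq_add_integral : ∀ z x : I, f x = f z + ∫ u in (z : ℝ)..x, ext g u

/-- Auxiliary: two generalized derivatives of the same function cannot be strictly ordered at a
point of `I`. -/
theorem HasGenDeriv.not_apply_lt (hI : I.OrdConnected) (hI' : I.Nontrivial) {w f g g' : I → ℝ}
    (hw : ∀ x, 0 < w x) (h : HasGenDeriv w f g) (h' : HasGenDeriv w f g') (x : I) :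
    ¬ g' x < g x := by
  intro hlt
  have : OrdConnected I := hI
  have : Nontrivial I := hI'.coe_sort
  have hd : 0 < (g / w - g' / w) x := by
    simp only [Pi.sub_apply, Pi.div_apply]
    rw [← sub_div]
    exact div_pos (sub_pos.2 hlt) (hw x)
  -- it suffices to find a nondegenerate interval in `I` on which `g' < g`
  suffices H : ∃ y z : I, y < z ∧ ∀ u : I, y < u → u < z → 0 < (g / w - g' / w) u by
    obtain ⟨y, z, hyz, hpos⟩ := H
    have hint : ∫ u in (y : ℝ)..z, (ext g u - ext g' u) = 0 := by
      rw [intervalIntegral.integral_sub (h.intervalIntegrable y z) (h'.intervalIntegrable y z)]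
      have e1 := h.eq_add_integral y z
      have e2 := h'.eq_add_integral y z
      linarith
    have hp : 0 < ∫ u in (y : ℝ)..z, (ext g u - ext g' u) := by
      refine intervalIntegral.intervalIntegral_pos_of_pos_on
        ((h.intervalIntegrable y z).sub (h'.intervalIntegrable y z)) (fun u hu => ?_) hyz
      have huI : u ∈ I := hI.out y.2 z.2 ⟨hu.1.le, hu.2.le⟩
      have := hpos ⟨u, huI⟩ hu.1 hu.2
      simp only [Pi.sub_apply, Pi.div_apply] at this
      rw [← sub_div] at this
      have h2 := (div_pos_iff_of_pos_right (hw ⟨u, huI⟩)).1 this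
      simpa [ext, huI] using h2
    exact hp.ne' hint
  by_cases hx : IsMax x
  · have hc : ContinuousWithinAt (g / w - g' / w) (Iic x) x :=
      (h.mem_LD.2 x hx).sub (h'.mem_LD.2 x hx)
    obtain ⟨y₀, hy₀⟩ := exists_ne x
    have hy₀x : y₀ < x := lt_of_le_of_ne (not_lt.1 fun hlt' => hx.not_lt hlt') hy₀
    obtain ⟨y, hy, hsub⟩ := (mem_nhdsLE_iff_exists_Ioc_subset' hy₀x).1
      (hc.eventually (lt_mem_nhds hd))
    exact ⟨y, x, hy, fun u h1 h2 => hsub ⟨h1, h2.le⟩⟩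
  · have hc : ContinuousWithinAt (g / w - g' / w) (Ici x) x :=
      (h.mem_LD.1 x hx).sub (h'.mem_LD.1 x hx)
    obtain ⟨y₀, hy₀⟩ := not_isMax_iff.1 hx
    obtain ⟨y, hy, hsub⟩ := (mem_nhdsGE_iff_exists_Ico_subset' hy₀).1
      (hc.eventually (lt_mem_nhds hd))
    exact ⟨x, y, hy, fun u h1 h2 => hsub ⟨h1.le, h2⟩⟩

/-- The generalized derivative is unique. -/
theorem HasGenDeriv.unique (hI : I.OrdConnected) (hI' : I.Nontrivial) {w f g g' : I → ℝ}
    (hw : ∀ x, 0 < w x) (h : HasGenDeriv w f g) (h' : HasGenDeriv w f g') : g = g' :=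
  funext fun x => le_antisymm (not_lt.1 (HasGenDeriv.not_apply_lt hI hI' hw h h' x))
    (not_lt.1 (HasGenDeriv.not_apply_lt hI hI' hw h' h x))

/-- The domain of the operator `D_w`. -/
def domD (w : I → ℝ) : Set (I → ℝ) :=
  {f | Measurable f ∧ ∃ g, HasGenDeriv w f g}

/-- The operator `D_w` on its domain `domD w` (and `0` off the domain). The function `D_w f` is
unique, see `HasGenDeriv.unique` above. -/
def genD (w f : I → ℝ) : I → ℝ :=
  open Classical in if h : ∃ g, HasGenDeriv w f g then h.choose else 0

theorem HasGenDeriv.genD_eq (hI : I.OrdConnected) (hI' : I.Nontrivial) {w f g : I → ℝ}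
    (hw : ∀ x, 0 < w x) (h : HasGenDeriv w f g) : genD w f = g := by
  have hex : ∃ g, HasGenDeriv w f g := ⟨g, h⟩
  rw [genD, dif_pos hex]
  exact hex.choose_spec.unique hI hI' hw h

/-- The gauged derivatives `f^(0) = f / w₀`, `f^(j+1) = (D_{w_{j+1}} f^(j)) / w_{j+1}`. -/
def gDeriv (w : ℕ → I → ℝ) : ℕ → (I → ℝ) → (I → ℝ)
  | 0, f => f / w 0
  | j + 1, f => genD (w (j + 1)) (gDeriv w j f) / w (j + 1)

/-- The domain of `f ↦ f^(j)`: all Borel functions for `j = 0`, and those `f` in the domain of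
the previous derivative with `f^(j)` in the domain of `D_{w_{j+1}}` for `j + 1`. -/
def dom (w : ℕ → I → ℝ) : ℕ → Set (I → ℝ)
  | 0 => {f | Measurable f}
  | j + 1 => {f | f ∈ dom w j ∧ gDeriv w j f ∈ domD (w (j + 1))}

/-- The `w`-polynomials of degree `≤ m`. -/
def polyLE (w : ℕ → I → ℝ) (m : ℕ) : Set (I → ℝ) :=
  {p | p ∈ dom w (m + 1) ∧ gDeriv w (m + 1) p = 0}

/-- The cone `F_+^{k:n}` of generalized multiply monotone functions: `f^(j)` is nondecreasing
for each `j` with `k - 1 ≤ j ≤ n`. -/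
def coneF (w : ℕ → I → ℝ) (k n : ℕ) : Set (I → ℝ) :=
  {f | f ∈ dom w n ∧ ∀ j, k ≤ j + 1 → j ≤ n → Monotone (gDeriv w j f)}

/-- The set `P_+^{k:n}` of the `w`-polynomials of degree `≤ n` that are in `F_+^{k:n}`. -/
def polyCone (w : ℕ → I → ℝ) (k n : ℕ) : Set (I → ℝ) :=
  polyLE w n ∩ coneF w k n

/-- For `t ∈ I`, the iterated integrals `pAux w t j d = p_{t;j,j+d}`, where `p_{t;m,m} = w_m`
and `p_{t;j,m}(x) = w_j(x) ∫_t^x p_{t;j+1,m}(u) du` for `j < m`. -/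
def pAux (w : ℕ → I → ℝ) (t : I) : ℕ → ℕ → I → ℝ
  | j, 0 => w j
  | j, d + 1 => fun x => w j x * ∫ u in (t : ℝ)..x, ext (pAux w t (j + 1) d) u

/-- The "positive part" `p^+_{t;0,n}(x) = p_{t;0,n}(x) 1{x ≥ t}`, for `t ∈ I`. -/
def pPlus (w : ℕ → I → ℝ) (n : ℕ) (t : I) : I → ℝ :=
  (Ici t).indicator (pAux w t 0 n)

/-- The integral `ν(f)` exists in the extended sense: `ν(f_+) < ∞` or `ν(f_-) < ∞`. -/
def IntegralExists (ν : Measure I) (f : I → ℝ) : Prop :=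
  ∫⁻ x, ENNReal.ofReal (f x) ∂ν < ∞ ∨ ∫⁻ x, ENNReal.ofReal (-f x) ∂ν < ∞

/-- `ν(f) = ν(f_+) - ν(f_-)` in `[-∞, ∞]`; meaningful when `IntegralExists ν f`. -/
def extIntegral (ν : Measure I) (f : I → ℝ) : EReal :=
  ((∫⁻ x, ENNReal.ofReal (f x) ∂ν : ℝ≥0∞) : EReal) -
    ((∫⁻ x, ENNReal.ofReal (-f x) ∂ν : ℝ≥0∞) : EReal)

/-- `ν₁(f) ≥ ν₂(f)`, including the existence of both integrals. -/
def IntegralGE (ν₁ ν₂ : Measure I) (f : I → ℝ) : Prop :=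
  IntegralExists ν₁ f ∧ IntegralExists ν₂ f ∧ extIntegral ν₂ f ≤ extIntegral ν₁ f

/-- `ν₁(f) = ν₂(f) ∈ ℝ`, including the existence of both integrals. -/
def IntegralEqReal (ν₁ ν₂ : Measure I) (f : I → ℝ) : Prop :=
  IntegralExists ν₁ f ∧ IntegralExists ν₂ f ∧
    ∃ c : ℝ, extIntegral ν₁ f = (c : EReal) ∧ extIntegral ν₂ f = (c : EReal)

/-- The admissible set `N_+(G)`: the nonnegative, not necessarily finite, Borel measures `ν` on
`I` such that `ν(f)` exists and is `> -∞` for all `f ∈ G`. -/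
def admissible (G : Set (I → ℝ)) : Set (Measure I) :=
  {ν | ∀ f ∈ G, IntegralExists ν f ∧ ⊥ < extIntegral ν f}

/-- The dual cone of `G`, a set of pairs of admissible measures. -/
def dualCone (G : Set (I → ℝ)) : Set (Measure I × Measure I) :=
  {ν | ν.1 ∈ admissible G ∧ ν.2 ∈ admissible G ∧ ∀ f ∈ G, IntegralGE ν.1 ν.2 f}

end GaugedCone

end

/-!
The dual cone is described by testing on polynomials and truncated powers because every `f` in
`F_+^{k:n}` is, up to a polynomial of degree at most `k - 1`, a limit of nonnegative combinations
of polynomials in the cone and truncated powers, in a sense strong enough for monotone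
convergence to apply under both measures.

*Necessity.* If `p` is a polynomial of degree at most `k - 1`, then `p` and `-p` are both in
`P_+^{k:n}` (`smul_mem_polyCone_of_mem_polyLE`), because monotonicity is only required from order
`k - 1` on. Admissibility for both makes the integrals of `p` finite, and domination for both
makes them equal.

*Sufficiency.* The top derivative `f^(n)` is nondecreasing, hence a limit of dyadic step
functions, i.e. of nonnegative combinations of indicators of upper sets (`dyadic`,
`ElemAt.dyadic_comp`). These are integrated back to order `0`.

* At the orders `j ≥ k` all functions are nonnegative, and `f^(j)` has a finite infimum, its limit
  at the left endpoint `a` of `I`. Since `f^(j+1) ≥ 0`, the density `f^(j+1) w_{j+1}` is integrable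
  down to `a`, so that `f^(j) = inf f^(j) + ∫_a f^(j+1) w_{j+1}` although `a` need not belong to
  `I` (`IsPrimitive.eq_iInf_add_lowerPrimitive`). Integration from `a` respects pointwise order and
  turns truncated powers into truncated powers and nonnegative polynomials into nonnegative
  polynomials.
* At the orders `j < k` one integrates from a fixed `z ∈ I`. To the right of `z` the order is kept,
  to the left of `z` it is reversed at each step (`SignedLE.primitive`), so that the approximations
  still increase in absolute value with a constant sign on either side of `z`. The constants of
  integration produce polynomials that only change derivatives of order less than `k`, and the
  Taylor polynomial of `f` at `z` of degree `k - 1` splits off (`coneF.exists_approx`).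

On the Taylor polynomial the measures agree by the first condition. For the rest, the positive and
negative parts of the approximations increase to those of the limit, so the inequality, which
holds for the approximations by the second and third conditions, passes to the limit
(`extIntegral_le_of_mem_coneF`). For `n = 0` the function `f^(0)` need not be right-continuous;
therefore indicators of open rays `(t, ∞)` occur in the step functions as well, and they are
increasing limits of truncated powers (`Dominates.ray`).
-/

noncomputable section

namespace GaugedCone

variable {I : Set ℝ}

/-! ### Measurable locally bounded functions and their primitives -/

theorem ext_apply_mem (g : I → ℝ) {u : ℝ} (h : u ∈ I) : ext g u = g ⟨u, h⟩ := dif_pos h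

theorem ext_apply_notMem (g : I → ℝ) {u : ℝ} (h : u ∉ I) : ext g u = 0 := dif_neg h

theorem ext_add (f g : I → ℝ) : ext (f + g) = ext f + ext g := by
  funext u
  by_cases h : u ∈ I <;> simp [ext, h]

theorem ext_smul (c : ℝ) (f : I → ℝ) : ext (c • f) = c • ext f := by
  funext u
  by_cases h : u ∈ I <;> simp [ext, h]

theorem ext_le_ext {f g : I → ℝ} {u : ℝ} (h : ∀ hu : u ∈ I, f ⟨u, hu⟩ ≤ g ⟨u, hu⟩) :
    ext f u ≤ ext g u := by
  by_cases hu : u ∈ I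
  · simpa [ext, hu] using h hu
  · simp [ext, hu]

theorem ext_nonneg {f : I → ℝ} {u : ℝ} (h : ∀ hu : u ∈ I, 0 ≤ f ⟨u, hu⟩) : 0 ≤ ext f u := by
  by_cases hu : u ∈ I
  · simpa [ext, hu] using h hu
  · simp [ext, hu]

theorem measurable_ext [hI : OrdConnected I] {g : I → ℝ} (hg : Measurable g) :
    Measurable (ext g) := by
  have he : ext g = Function.extend Subtype.val g 0 := by
    funext u
    by_cases h : u ∈ I
    · rw [ext_apply_mem g h]
      exact (Subtype.val_injective.extend_apply g 0 ⟨u, h⟩).symm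
    · rw [ext_apply_notMem g h, Function.extend_apply' _ _ _ (by rintro ⟨a, rfl⟩; exact h a.2)]
      rfl
  rw [he]
  exact (MeasurableEmbedding.subtype_coe hI.measurableSet).measurable_extend hg measurable_const

/-- Borel measurable and bounded on compact subsets of `I`. -/
structure LocBdd (f : I → ℝ) : Prop where
  measurable : Measurable f
  bounded : LocallyBounded f

namespace LocBdd

theorem const (c : ℝ) : LocBdd (fun _ : I => c) :=
  ⟨measurable_const, fun _ _ => ⟨|c|, fun _ _ => le_rfl⟩⟩

theorem add {f g : I → ℝ} (hf : LocBdd f) (hg : LocBdd g) : LocBdd (f + g) := by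
  refine ⟨hf.1.add hg.1, fun K hK => ?_⟩
  obtain ⟨C, hC⟩ := hf.2 K hK
  obtain ⟨D, hD⟩ := hg.2 K hK
  exact ⟨C + D, fun x hx => (abs_add_le _ _).trans (add_le_add (hC x hx) (hD x hx))⟩

theorem mul {f g : I → ℝ} (hf : LocBdd f) (hg : LocBdd g) : LocBdd (f * g) := by
  refine ⟨hf.1.mul hg.1, fun K hK => ?_⟩
  obtain ⟨C, hC⟩ := hf.2 K hK
  obtain ⟨D, hD⟩ := hg.2 K hK
  refine ⟨C * D, fun x hx => ?_⟩
  rw [Pi.mul_apply, abs_mul]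
  exact mul_le_mul (hC x hx) (hD x hx) (abs_nonneg _) ((abs_nonneg _).trans (hC x hx))

theorem smul {f : I → ℝ} (hf : LocBdd f) (c : ℝ) : LocBdd (c • f) :=
  (LocBdd.const c).mul hf

theorem sub {f g : I → ℝ} (hf : LocBdd f) (hg : LocBdd g) : LocBdd (f - g) := by
  have := hf.add (hg.smul (-1))
  rwa [neg_one_smul, ← sub_eq_add_neg] at this

theorem of_continuous {f : I → ℝ} (hf : Continuous f) : LocBdd f := by
  refine ⟨hf.measurable, fun K hK => ?_⟩
  obtain ⟨C, hC⟩ := hK.exists_bound_of_continuousOn hf.continuousOn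
  exact ⟨C, hC⟩

theorem of_monotone [OrdConnected I] {f : I → ℝ} (hf : Monotone f) : LocBdd f := by
  refine ⟨hf.measurable, fun K hK => ?_⟩
  rcases K.eq_empty_or_nonempty with rfl | hne
  · exact ⟨0, by simp⟩
  obtain ⟨a, -, ha⟩ := hK.exists_isLeast hne
  obtain ⟨b, -, hb⟩ := hK.exists_isGreatest hne
  exact ⟨max |f a| |f b|, fun x hx => abs_le_max_abs_abs (hf (ha hx)) (hf (hb hx))⟩

theorem intervalIntegrable [hI : OrdConnected I] {g : I → ℝ} (hg : LocBdd g) (z x : I) :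
    IntervalIntegrable (ext g) volume z x := by
  have hsub : uIcc (z : ℝ) x ⊆ I := hI.uIcc_subset z.2 x.2
  have hc : IsCompact (Subtype.val ⁻¹' uIcc (z : ℝ) x : Set I) := by
    rw [Topology.IsInducing.subtypeVal.isCompact_preimage_iff (by simpa using hsub)]
    exact isCompact_uIcc
  obtain ⟨C, hC⟩ := hg.2 _ hc
  rw [intervalIntegrable_iff]
  refine Measure.integrableOn_of_bounded (M := C) measure_Ioc_lt_top.ne
    (measurable_ext hg.1).aestronglyMeasurable ?_
  filter_upwards [ae_restrict_mem measurableSet_uIoc] with u hu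
  have hu' := uIoc_subset_uIcc hu
  rw [ext_apply_mem g (hsub hu')]
  exact hC ⟨u, hsub hu'⟩ hu'

end LocBdd

theorem IsGauge.locBdd {w : ℕ → I → ℝ} (hw : IsGauge w) (j : ℕ) : LocBdd (w j) :=
  ⟨hw.measurable j, hw.locallyBounded j⟩

/-- `ψ` is an indefinite integral of `φ` with respect to the measure of density `v`. -/
def IsPrimitive (v φ ψ : I → ℝ) : Prop :=
  ∀ z x : I, ψ x = ψ z + ∫ u in (z : ℝ)..x, ext (φ * v) u

/-- The indefinite integral of `φ` with respect to the measure of density `v` that vanishes at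
the point `z`. -/
def primitive (z : I) (v φ : I → ℝ) (x : I) : ℝ :=
  ∫ u in (z : ℝ)..x, ext (φ * v) u

/-- The indefinite integral of `φ` with respect to the measure of density `v` that vanishes at
the left endpoint of `I`, whether or not this endpoint is finite or belongs to `I`. -/
def lowerPrimitive (v φ : I → ℝ) (x : I) : ℝ :=
  ∫ u in Iic (x : ℝ), ext (φ * v) u

section Primitive

variable {v φ φ' ψ : I → ℝ}

theorem primitive_self (z : I) (v φ : I → ℝ) : primitive z v φ z = 0 :=
  intervalIntegral.integral_same

theorem IsPrimitive.eq_add_primitive (h : IsPrimitive v φ ψ) (z : I) :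
    ψ = (fun _ => ψ z) + primitive z v φ :=
  funext fun x => h z x

theorem IsPrimitive.const_add (h : IsPrimitive v φ ψ) (c : ℝ) :
    IsPrimitive v φ ((fun _ => c) + ψ) := fun z x => by
  simp only [Pi.add_apply]
  rw [h z x, add_assoc]

theorem IsPrimitive.smul (h : IsPrimitive v φ ψ) (c : ℝ) :
    IsPrimitive v (c • φ) (c • ψ) := fun z x => by
  simp only [Pi.smul_apply, smul_mul_assoc, ext_smul, intervalIntegral.integral_smul]
  rw [h z x, smul_add]

theorem isPrimitive_primitive (h : ∀ z x : I, IntervalIntegrable (ext (φ * v)) volume z x)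
    (z : I) : IsPrimitive v φ (primitive z v φ) := fun y x => by
  rw [primitive, primitive, intervalIntegral.integral_add_adjacent_intervals (h z y) (h y x)]

theorem isPrimitive_lowerPrimitive
    (h : ∀ x : I, IntegrableOn (ext (φ * v)) (Iic (x : ℝ))) :
    IsPrimitive v φ (lowerPrimitive v φ) := fun y x => by
  rw [lowerPrimitive, lowerPrimitive, ← intervalIntegral.integral_Iic_sub_Iic (h y) (h x)]
  ring

theorem IsPrimitive.const (v : I → ℝ) (c : ℝ) :
    IsPrimitive v (fun _ => 0) (fun _ => c) := fun z x => by
  have : ext ((fun _ : I => (0 : ℝ)) * v) = fun _ => 0 := by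
    funext u
    by_cases h : u ∈ I <;> simp [ext, h]
  simp [this]

theorem IsPrimitive.continuous [OrdConnected I] (h : IsPrimitive v φ ψ)
    (hi : ∀ z x : I, IntervalIntegrable (ext (φ * v)) volume z x) : Continuous ψ := by
  rw [continuous_iff_continuousAt]
  intro x
  obtain ⟨b, c, hx, hmem, -⟩ := exists_Icc_mem_subset_of_mem_nhds (univ_mem : univ ∈ 𝓝 x)
  have hbc : b ≤ c := hx.1.trans hx.2
  have hF : ContinuousWithinAt (fun y : ℝ => ∫ u in (b : ℝ)..y, ext (φ * v) u) (Icc b c) x := by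
    refine intervalIntegral.continuousWithinAt_primitive (by simp) ?_
    have e1 : min (b : ℝ) b = b := min_self _
    have e2 : max (b : ℝ) c = c := max_eq_right hbc
    rw [e1, e2]
    exact hi b c
  rw [funext fun y => h b y]
  refine continuousAt_const.add ?_
  refine Tendsto.comp hF (tendsto_nhdsWithin_iff.2 ⟨continuous_subtype_val.continuousAt, ?_⟩)
  filter_upwards [hmem] with y hy using ⟨hy.1, hy.2⟩

theorem IsPrimitive.monotone [OrdConnected I] (h : IsPrimitive v φ ψ) (hφ : 0 ≤ φ)
    (hv : ∀ x, 0 < v x) : Monotone ψ := fun z x hzx => by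
  rw [h z x, le_add_iff_nonneg_right]
  exact intervalIntegral.integral_nonneg hzx fun u _ =>
    ext_nonneg fun hu => mul_nonneg (hφ _) (hv _).le

theorem primitive_add [OrdConnected I] (hφ : LocBdd φ) (hφ' : LocBdd φ') (hv : LocBdd v)
    (z : I) : primitive z v (φ + φ') = primitive z v φ + primitive z v φ' := by
  funext x
  simp only [primitive, Pi.add_apply, add_mul, ext_add]
  exact intervalIntegral.integral_add ((hφ.mul hv).intervalIntegrable z x)
    ((hφ'.mul hv).intervalIntegrable z x)

theorem primitive_smul (c : ℝ) (z : I) :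
    primitive z v (c • φ) = c • primitive z v φ := by
  funext x
  simp only [primitive, Pi.smul_apply, smul_mul_assoc, ext_smul, intervalIntegral.integral_smul]

theorem lowerPrimitive_add (h : ∀ x : I, IntegrableOn (ext (φ * v)) (Iic (x : ℝ)))
    (h' : ∀ x : I, IntegrableOn (ext (φ' * v)) (Iic (x : ℝ))) :
    lowerPrimitive v (φ + φ') = lowerPrimitive v φ + lowerPrimitive v φ' := by
  funext x
  simp only [lowerPrimitive, Pi.add_apply, add_mul, ext_add]
  exact integral_add (h x) (h' x)

theorem lowerPrimitive_smul (c : ℝ) :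
    lowerPrimitive v (c • φ) = c • lowerPrimitive v φ := by
  funext x
  simp only [lowerPrimitive, Pi.smul_apply, smul_mul_assoc, ext_smul]
  exact integral_smul c _

/-- A nonnegative function with a primitive that is bounded below is integrable down to the
left endpoint of `I`, and the primitive tends to its infimum there. -/
theorem IsPrimitive.eq_iInf_add_lowerPrimitive [hI : OrdConnected I] (h : IsPrimitive v φ ψ)
    (hi : ∀ z x : I, IntervalIntegrable (ext (φ * v)) volume z x) (hφ : 0 ≤ φ)
    (hv : ∀ x, 0 < v x) (hψ : BddBelow (range ψ)) :
    (∀ x : I, IntegrableOn (ext (φ * v)) (Iic (x : ℝ))) ∧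
      ψ = (fun _ => ⨅ y, ψ y) + lowerPrimitive v φ := by
  have hmono : Monotone ψ := h.monotone hφ hv
  have hnn : ∀ u, 0 ≤ ext (φ * v) u := fun u =>
    ext_nonneg fun _ => mul_nonneg (hφ _) (hv _).le
  have key : ∀ x : I, IntegrableOn (ext (φ * v)) (Iic (x : ℝ)) ∧
      ∫ u in Iic (x : ℝ), ext (φ * v) u = ψ x - ⨅ y, ψ y := by
    intro x
    have : Nonempty I := ⟨x⟩
    have hSm : MeasurableSet (I ∩ Iic (x : ℝ)) := hI.measurableSet.inter measurableSet_Iic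
    -- the intervals `(y, x]` exhaust `I ∩ (-∞, x]` up to at most one point, the minimum of `I`
    have hcov : AECover (volume.restrict (I ∩ Iic (x : ℝ))) (atBot : Filter I)
        fun y => Ioc (y : ℝ) x := by
      refine ⟨?_, fun y => measurableSet_Ioc⟩
      have hne : ∀ᵐ u ∂volume.restrict (I ∩ Iic (x : ℝ)), u ∉ {u : ℝ | IsLeast I u} := by
        refine ae_restrict_of_ae (measure_eq_zero_iff_ae_notMem.1 ?_)
        exact (Set.subsingleton_of_forall_eq (sInf I)
          fun u (hu : IsLeast I u) => hu.isGLB.csInf_eq ⟨x, x.2⟩ ▸ rfl).measure_zero _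
      filter_upwards [hne, ae_restrict_mem hSm] with u hu huI
      obtain ⟨y, hyI, hyu⟩ : ∃ y ∈ I, y < u := by
        by_contra! hc
        exact hu ⟨huI.1, fun y hy => hc y hy⟩
      filter_upwards [eventually_le_atBot (⟨y, hyI⟩ : I)] with y' hy'
      exact ⟨lt_of_le_of_lt hy' hyu, huI.2⟩
    have hsub : ∀ y : I, Ioc (y : ℝ) x ⊆ I ∩ Iic (x : ℝ) := fun y u hu =>
      ⟨hI.out y.2 x.2 ⟨hu.1.le, hu.2⟩, hu.2⟩
    have hrr : ∀ y : I, (volume.restrict (I ∩ Iic (x : ℝ))).restrict (Ioc (y : ℝ) x) =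
        volume.restrict (Ioc (y : ℝ) x) := fun y =>
      Measure.restrict_restrict_of_subset (hsub y)
    have hval : ∀ᶠ y : I in atBot,
        ∫ u in Ioc (y : ℝ) x, ext (φ * v) u ∂(volume.restrict (I ∩ Iic (x : ℝ))) =
          ψ x - ψ y := by
      filter_upwards [eventually_le_atBot x] with y hy
      rw [hrr, ← intervalIntegral.integral_of_le (show (y : ℝ) ≤ x from hy), h y x]
      ring
    have hint : Integrable (ext (φ * v)) (volume.restrict (I ∩ Iic (x : ℝ))) := by
      refine hcov.integrable_of_integral_bounded_of_nonneg_ae (ψ x - ⨅ y, ψ y) (fun y => ?_)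
        (Eventually.of_forall hnn) ?_
      · rw [IntegrableOn, hrr]
        exact (hi y x).1
      · filter_upwards [hval] with y hy
        rw [hy]
        exact sub_le_sub_left (ciInf_le hψ y) _
    have hlim : Tendsto (fun y : I => ψ x - ψ y) atBot (𝓝 (ψ x - ⨅ y, ψ y)) :=
      (tendsto_atBot_ciInf hmono hψ).const_sub _
    have hzero : ∀ u ∈ Iic (x : ℝ) \ (I ∩ Iic (x : ℝ)), ext (φ * v) u = 0 := fun u hu =>
      ext_apply_notMem _ fun h' => hu.2 ⟨h', hu.1⟩
    refine ⟨IntegrableOn.of_forall_sdiff_eq_zero hint measurableSet_Iic hzero, ?_⟩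
    rw [setIntegral_eq_of_subset_of_forall_sdiff_eq_zero measurableSet_Iic inter_subset_right
      hzero]
    exact hcov.integral_eq_of_tendsto _ hint (hlim.congr' (hval.mono fun y hy => hy.symm))
  refine ⟨fun x => (key x).1, funext fun x => ?_⟩
  simp [lowerPrimitive, (key x).2]

end Primitive

/-! ### Polynomials and elementary functions at a given order of differentiation -/

/-- `PolyAt w k d j q`: the function `q` is the gauged derivative of order `j` of a
`w`-polynomial of degree at most `j + d`, and its derivatives of orders `k, …, j + d` (as far as
they are derivatives of `q`) are nonnegative. The gauged derivatives are encoded as the chain of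
functions of which each is a primitive of the next, ending with a constant. -/
def PolyAt (w : ℕ → I → ℝ) (k : ℕ) : ℕ → ℕ → (I → ℝ) → Prop
  | 0, j, q => (k ≤ j → 0 ≤ q) ∧ ∃ c : ℝ, q = fun _ => c
  | d + 1, j, q => (k ≤ j → 0 ≤ q) ∧ ∃ q', PolyAt w k d (j + 1) q' ∧ IsPrimitive (w (j + 1)) q' q

/-- The truncated power `p_{t;j,j+d} 1{· ≥ t} / w_j`, formally the gauged derivative of order `j`
of `p⁺_{t;0,j+d}`. -/
def truncPow (w : ℕ → I → ℝ) (t : I) : ℕ → ℕ → I → ℝ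
  | 0, _ => (Ici t).indicator fun _ => 1
  | d + 1, j => primitive t (w (j + 1)) (truncPow w t d (j + 1))

/-- The elementary functions: the convex cone generated by the functions of `PolyAt w k d j` and the
truncated powers, formally the gauged derivatives of order `j` of the cone generated by
`P_+^{k:j+d}` and the `p⁺_{t;0,j+d}`. At top order `d = 0` the indicators of the open rays are
included, too. -/
inductive ElemAt (w : ℕ → I → ℝ) (k : ℕ) : ℕ → ℕ → (I → ℝ) → Prop
  | poly {d j : ℕ} {q : I → ℝ} : PolyAt w k d j q → ElemAt w k d j q
  | trunc (d j : ℕ) (t : I) : ElemAt w k d j (truncPow w t d j)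
  | ray (j : ℕ) (t : I) : ElemAt w k 0 j ((Ioi t).indicator fun _ => 1)
  | add {d j : ℕ} {φ ψ : I → ℝ} : ElemAt w k d j φ → ElemAt w k d j ψ → ElemAt w k d j (φ + ψ)
  | smul {d j : ℕ} {φ : I → ℝ} {c : ℝ} : 0 < c → ElemAt w k d j φ → ElemAt w k d j (c • φ)

section

variable {w : ℕ → I → ℝ} {k : ℕ}

theorem PolyAt.nonneg {d j : ℕ} {q : I → ℝ} (h : PolyAt w k d j q) (hj : k ≤ j) : 0 ≤ q := by
  cases d <;> exact h.1 hj

theorem PolyAt.continuous [OrdConnected I] (hw : IsGauge w) {d j : ℕ} {q : I → ℝ}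
    (h : PolyAt w k d j q) : Continuous q := by
  induction d generalizing j q with
  | zero =>
    obtain ⟨-, c, rfl⟩ := h
    exact continuous_const
  | succ d ih =>
    obtain ⟨-, q', hq', hp⟩ := h
    exact hp.continuous ((LocBdd.of_continuous (ih hq')).mul (hw.locBdd _)).intervalIntegrable

theorem PolyAt.locBdd [OrdConnected I] (hw : IsGauge w) {d j : ℕ} {q : I → ℝ}
    (h : PolyAt w k d j q) : LocBdd q :=
  LocBdd.of_continuous (h.continuous hw)

theorem PolyAt.monotone [OrdConnected I] (hw : IsGauge w) {d j : ℕ} {q : I → ℝ}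
    (h : PolyAt w k d j q) (hj : k ≤ j + 1) : Monotone q := by
  cases d with
  | zero =>
    obtain ⟨-, c, rfl⟩ := h
    exact monotone_const
  | succ d =>
    obtain ⟨-, q', hq', hp⟩ := h
    exact hp.monotone (hq'.nonneg hj) (hw.pos _)

theorem PolyAt.const (w : ℕ → I → ℝ) {k : ℕ} (d j : ℕ) {c : ℝ} (hc : k ≤ j → 0 ≤ c) :
    PolyAt w k d j fun _ => c := by
  induction d generalizing j c with
  | zero => exact ⟨fun h _ => hc h, c, rfl⟩
  | succ d ih =>
    exact ⟨fun h _ => hc h, _, ih (j + 1) fun _ => le_rfl, IsPrimitive.const _ c⟩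

theorem truncPow_of_lt (w : ℕ → I → ℝ) {t x : I} (hx : x < t) (d j : ℕ) :
    truncPow w t d j x = 0 := by
  induction d generalizing j x with
  | zero => exact indicator_of_notMem (by simpa using hx) _
  | succ d ih =>
    have hle : (x : ℝ) ≤ t := hx.le
    rw [truncPow, primitive, intervalIntegral.integral_of_ge hle, neg_eq_zero,
      integral_Ioc_eq_integral_Ioo]
    refine setIntegral_eq_zero_of_forall_eq_zero fun u hu => ?_
    by_cases huI : u ∈ I
    · rw [ext_apply_mem _ huI, Pi.mul_apply, ih (x := ⟨u, huI⟩) hu.2, zero_mul]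
    · exact ext_apply_notMem _ huI

theorem truncPow_mul_of_le [hI : OrdConnected I] (w : ℕ → I → ℝ) {t x : I} (hx : t ≤ x)
    (d j : ℕ) : w j x * truncPow w t d j x = pAux w t j d x := by
  induction d generalizing j x with
  | zero => simp [truncPow, pAux, hx]
  | succ d ih =>
    rw [truncPow, primitive, pAux]
    congr 1
    refine intervalIntegral.integral_congr fun u hu => ?_
    rw [uIcc_of_le (show (t : ℝ) ≤ x from hx)] at hu
    have huI : u ∈ I := hI.out t.2 x.2 hu
    simp only [ext_apply_mem _ huI, Pi.mul_apply]
    rw [mul_comm]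
    exact ih (x := ⟨u, huI⟩) hu.1 _

theorem mul_truncPow_eq_pPlus [OrdConnected I] (w : ℕ → I → ℝ) (t : I) (n : ℕ) :
    w 0 * truncPow w t n 0 = pPlus w n t := by
  funext x
  rw [pPlus, Pi.mul_apply]
  rcases le_or_gt t x with hx | hx
  · rw [indicator_of_mem (by exact hx), truncPow_mul_of_le w hx]
  · rw [indicator_of_notMem (by simpa using hx), truncPow_of_lt w hx, mul_zero]

theorem monotone_indicator_Ici (t : I) : Monotone ((Ici t).indicator fun _ => (1 : ℝ)) := by
  intro x y hxy
  by_cases hx : t ≤ x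
  · simp [hx, hx.trans hxy]
  · simpa [hx] using indicator_nonneg (fun _ _ => zero_le_one) y

theorem monotone_indicator_Ioi (t : I) : Monotone ((Ioi t).indicator fun _ => (1 : ℝ)) := by
  intro x y hxy
  by_cases hx : t < x
  · simp [hx, hx.trans_le hxy]
  · simpa [hx] using indicator_nonneg (fun _ _ => zero_le_one) y

theorem locBdd_truncPow [OrdConnected I] (hw : IsGauge w) (t : I) (d j : ℕ) :
    LocBdd (truncPow w t d j) := by
  induction d generalizing j with
  | zero => exact LocBdd.of_monotone (monotone_indicator_Ici t)
  | succ d ih =>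
    have hi := ((ih (j + 1)).mul (hw.locBdd (j + 1))).intervalIntegrable
    exact LocBdd.of_continuous ((isPrimitive_primitive hi t).continuous hi)

theorem truncPow_nonneg (hw : IsGauge w) (t : I) (d j : ℕ) : 0 ≤ truncPow w t d j := by
  induction d generalizing j with
  | zero => exact fun x => indicator_nonneg (fun _ _ => zero_le_one) x
  | succ d ih =>
    intro x
    rcases le_or_gt t x with hx | hx
    · exact intervalIntegral.integral_nonneg hx fun u _ =>
        ext_nonneg fun hu => mul_nonneg (ih _ _) (hw.pos _ _).le
    · exact (truncPow_of_lt w hx _ _).ge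

theorem ext_ray_ae_eq (v : I → ℝ) (t : I) :
    ext (((Ioi t).indicator fun _ => (1 : ℝ)) * v) =ᵐ[volume]
      ext (((Ici t).indicator fun _ => 1) * v) := by
  filter_upwards [measure_eq_zero_iff_ae_notMem.1 (measure_singleton (μ := volume) (t : ℝ))]
    with u hu
  by_cases huI : u ∈ I
  · have hne : t ≠ ⟨u, huI⟩ := fun h => hu (by simp [h])
    rw [ext_apply_mem _ huI, ext_apply_mem _ huI, Pi.mul_apply, Pi.mul_apply]
    congr 1
    simp only [indicator, mem_Ioi, mem_Ici, hne.le_iff_lt]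
  · rw [ext_apply_notMem _ huI, ext_apply_notMem _ huI]

theorem lowerPrimitive_eq_primitive {φ v : I → ℝ} {t : I}
    (hφ : ∀ x < t, φ x = 0) (hi : ∀ x : I, IntegrableOn (ext (φ * v)) (Iic (x : ℝ))) :
    lowerPrimitive v φ = primitive t v φ := by
  have h0 : lowerPrimitive v φ t = 0 := by
    rw [lowerPrimitive, ← setIntegral_congr_set Iio_ae_eq_Iic]
    refine setIntegral_eq_zero_of_forall_eq_zero fun u hu => ?_
    by_cases huI : u ∈ I
    · rw [ext_apply_mem _ huI, Pi.mul_apply, hφ ⟨u, huI⟩ hu, zero_mul]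
    · exact ext_apply_notMem _ huI
  rw [(isPrimitive_lowerPrimitive hi).eq_add_primitive t, h0]
  exact zero_add _

namespace ElemAt

variable {d j : ℕ} {φ : I → ℝ}

theorem locBdd [OrdConnected I] (hw : IsGauge w) (h : ElemAt w k d j φ) : LocBdd φ := by
  induction h with
  | poly h => exact h.locBdd hw
  | trunc d j t => exact locBdd_truncPow hw t d j
  | ray j t => exact LocBdd.of_monotone (monotone_indicator_Ioi t)
  | add _ _ h1 h2 => exact h1.add h2
  | smul _ _ h => exact h.smul _

theorem nonneg (hw : IsGauge w) (h : ElemAt w k d j φ) (hj : k ≤ j) : 0 ≤ φ := by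
  induction h with
  | poly h => exact h.nonneg hj
  | trunc d j t => exact truncPow_nonneg hw t d j
  | ray j t => exact fun x => indicator_nonneg (fun _ _ => zero_le_one) x
  | add _ _ h1 h2 => exact fun x => add_nonneg (h1 hj x) (h2 hj x)
  | smul hc _ h => exact fun x => mul_nonneg hc.le (h hj x)

theorem const (d j : ℕ) {c : ℝ} (hc : k ≤ j → 0 ≤ c) : ElemAt w k d j fun _ => c :=
  poly (PolyAt.const w d j hc)

/-- Below the order `k`, integration from a point of `I` preserves elementary functions: the
constant of integration contributes a polynomial, whose sign does not matter there. -/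
theorem primitive [OrdConnected I] (hw : IsGauge w) (z : I) {i : ℕ} (h : ElemAt w k d i φ)
    (hij : i = j + 1) (hj : j < k) :
    ElemAt w k (d + 1) j (GaugedCone.primitive z (w (j + 1)) φ) := by
  have key : ∀ (d : ℕ) (t : I), ElemAt w k (d + 1) j
      (GaugedCone.primitive z (w (j + 1)) (truncPow w t d (j + 1))) := fun d t => by
    have hi := ((locBdd_truncPow hw t d (j + 1)).mul (hw.locBdd (j + 1))).intervalIntegrable
    have e := (isPrimitive_primitive hi z).eq_add_primitive t
    rw [e]
    exact (const _ _ fun hk => absurd hj hk.not_gt).add (trunc (d + 1) j t)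
  induction h with
  | poly h =>
    subst hij
    exact poly ⟨fun hk => absurd hj hk.not_gt, _, h,
      isPrimitive_primitive ((h.locBdd hw).mul (hw.locBdd _)).intervalIntegrable z⟩
  | trunc d i t => subst hij; exact key d t
  | ray i t =>
    have e : GaugedCone.primitive z (w (j + 1)) ((Ioi t).indicator fun _ => 1) =
        GaugedCone.primitive z (w (j + 1)) (truncPow w t 0 (j + 1)) :=
      funext fun x => intervalIntegral.integral_congr_ae_restrict
        (ae_restrict_of_ae (ext_ray_ae_eq _ t))
    rw [e]
    exact key 0 t
  | add h1 h2 ih1 ih2 =>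
    rw [primitive_add (h1.locBdd hw) (h2.locBdd hw) (hw.locBdd _)]
    exact (ih1 hij).add (ih2 hij)
  | smul hc _ ih =>
    rw [primitive_smul]
    exact (ih hij).smul hc

/-- From the order `k` on, integration from the left endpoint of `I` preserves elementary
functions. -/
theorem lowerPrimitive [OrdConnected I] (hw : IsGauge w) {i : ℕ} (h : ElemAt w k d i φ)
    (hij : i = j + 1) (hj : k ≤ j)
    (hi : ∀ x : I, IntegrableOn (ext (φ * w (j + 1))) (Iic (x : ℝ))) :
    ElemAt w k (d + 1) j (GaugedCone.lowerPrimitive (w (j + 1)) φ) := by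
  induction h with
  | poly h =>
    subst hij
    refine poly ⟨fun _ x => ?_, _, h, isPrimitive_lowerPrimitive hi⟩
    exact setIntegral_nonneg measurableSet_Iic fun u _ =>
      ext_nonneg fun _ => mul_nonneg (h.nonneg (hj.trans j.le_succ) _) (hw.pos _ _).le
  | trunc d i t =>
    subst hij
    rw [lowerPrimitive_eq_primitive (t := t) (fun x hx => truncPow_of_lt w hx _ _) hi]
    exact trunc (d + 1) j t
  | ray i t =>
    rw [lowerPrimitive_eq_primitive (t := t)
      (fun x hx => indicator_of_notMem (by simpa using hx.le) _) hi]
    have e : GaugedCone.primitive t (w (j + 1)) ((Ioi t).indicator fun _ => 1) =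
        truncPow w t 1 j :=
      funext fun x => intervalIntegral.integral_congr_ae_restrict
        (ae_restrict_of_ae (ext_ray_ae_eq _ t))
    rw [e]
    exact trunc 1 j t
  | @add d i φ ψ h1 h2 ih1 ih2 =>
    subst hij
    have hk : k ≤ j + 1 := hj.trans j.le_succ
    -- both summands are nonnegative, hence integrable as soon as their sum is
    have hdom : ∀ {f g : I → ℝ}, LocBdd f → 0 ≤ f → f ≤ g →
        (∀ x : I, IntegrableOn (ext (g * w (j + 1))) (Iic (x : ℝ))) →
        ∀ x : I, IntegrableOn (ext (f * w (j + 1))) (Iic (x : ℝ)) := by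
      intro f g hf hf0 hfg hg x
      refine (hg x).mono' (measurable_ext (hf.mul (hw.locBdd _)).1).aestronglyMeasurable
        (Eventually.of_forall fun u => ?_)
      rw [Real.norm_of_nonneg (ext_nonneg fun _ => mul_nonneg (hf0 _) (hw.pos _ _).le)]
      exact ext_le_ext fun _ => mul_le_mul_of_nonneg_right (hfg _) (hw.pos _ _).le
    have hi1 := hdom (h1.locBdd hw) (h1.nonneg hw hk) (le_add_of_nonneg_right (h2.nonneg hw hk)) hi
    have hi2 := hdom (h2.locBdd hw) (h2.nonneg hw hk) (le_add_of_nonneg_left (h1.nonneg hw hk)) hi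
    rw [lowerPrimitive_add hi1 hi2]
    exact (ih1 rfl hi1).add (ih2 rfl hi2)
  | @smul d i φ c hc _ ih =>
    rw [lowerPrimitive_smul]
    refine (ih hij fun x => ?_).smul hc
    have := hi x
    rw [smul_mul_assoc, ext_smul] at this
    exact (integrable_fun_smul_iff hc.ne' _).1 this

end ElemAt

end

/-! ### Step approximation of monotone functions -/

/-- The `m`-th dyadic approximation from below of the positive part of a real number `y`. -/
def dyadic (m : ℕ) (y : ℝ) : ℝ := (min (m * 2 ^ m) ⌊2 ^ m * y⌋₊ : ℕ) / 2 ^ m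

theorem dyadic_nonneg (m : ℕ) (y : ℝ) : 0 ≤ dyadic m y := by
  unfold dyadic
  positivity

theorem dyadic_of_nonpos (m : ℕ) {y : ℝ} (hy : y ≤ 0) : dyadic m y = 0 := by
  have : (2 : ℝ) ^ m * y ≤ 0 := mul_nonpos_of_nonneg_of_nonpos (by positivity) hy
  simp [dyadic, Nat.floor_of_nonpos this]

theorem dyadic_le (m : ℕ) {y : ℝ} (hy : 0 ≤ y) : dyadic m y ≤ y := by
  rw [dyadic, div_le_iff₀ (by positivity), mul_comm y]
  exact (Nat.cast_le.2 (min_le_right _ _)).trans (Nat.floor_le (by positivity))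

theorem dyadic_le_succ (m : ℕ) (y : ℝ) : dyadic m y ≤ dyadic (m + 1) y := by
  rcases le_or_gt y 0 with hy | hy
  · rw [dyadic_of_nonpos m hy, dyadic_of_nonpos (m + 1) hy]
  rw [dyadic, dyadic, div_le_div_iff₀ (by positivity) (by positivity), pow_succ,
    mul_comm ((2 : ℝ) ^ m) 2, ← mul_assoc]
  refine mul_le_mul_of_nonneg_right ?_ (by positivity)
  have h : min (m * 2 ^ m) ⌊2 ^ m * y⌋₊ * 2 ≤
      min ((m + 1) * (2 ^ m * 2)) ⌊2 * 2 ^ m * y⌋₊ := by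
    refine le_min ?_ (Nat.le_floor ?_)
    · calc min (m * 2 ^ m) ⌊2 ^ m * y⌋₊ * 2 ≤ m * 2 ^ m * 2 :=
            Nat.mul_le_mul_right _ (min_le_left _ _)
        _ ≤ (m + 1) * (2 ^ m * 2) := by rw [mul_assoc]; exact Nat.mul_le_mul_right _ m.le_succ
    · have h1 : ((min (m * 2 ^ m) ⌊2 ^ m * y⌋₊ : ℕ) : ℝ) ≤ 2 ^ m * y :=
        (Nat.cast_le.2 (min_le_right _ _)).trans (Nat.floor_le (by positivity))
      push_cast at h1 ⊢
      linarith
  rw [pow_succ]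
  exact_mod_cast h

theorem tendsto_dyadic {y : ℝ} (hy : 0 ≤ y) :
    Tendsto (fun m => dyadic m y) atTop (𝓝 y) := by
  have h2 : Tendsto (fun m : ℕ => y - (1 / 2 : ℝ) ^ m) atTop (𝓝 y) := by
    simpa using (tendsto_pow_atTop_nhds_zero_of_lt_one (by norm_num : (0 : ℝ) ≤ 1 / 2)
      (by norm_num)).const_sub y
  refine tendsto_of_tendsto_of_tendsto_of_le_of_le' h2 tendsto_const_nhds ?_
    (Eventually.of_forall fun m => dyadic_le m hy)
  filter_upwards [eventually_ge_atTop ⌈y⌉₊] with m hm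
  have hym : y ≤ m := (Nat.le_ceil y).trans (Nat.cast_le.2 hm)
  have hfl : ⌊2 ^ m * y⌋₊ ≤ m * 2 ^ m := by
    have : (⌊2 ^ m * y⌋₊ : ℝ) ≤ m * 2 ^ m := by
      refine (Nat.floor_le (by positivity)).trans ?_
      rw [mul_comm]
      exact mul_le_mul_of_nonneg_right hym (by positivity)
    exact_mod_cast this
  rw [dyadic, min_eq_right hfl, le_div_iff₀ (by positivity), sub_mul, one_div, inv_pow,
    inv_mul_cancel₀ (by positivity), mul_comm y]
  linarith [Nat.lt_floor_add_one (2 ^ m * y)]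

theorem dyadic_eq_sum (m : ℕ) (y : ℝ) :
    dyadic m y = ∑ i ∈ Finset.range (m * 2 ^ m),
      (2 ^ m : ℝ)⁻¹ * {v : ℝ | (i + 1 : ℝ) ≤ 2 ^ m * v}.indicator (fun _ => 1) y := by
  classical
  rw [← Finset.mul_sum, dyadic, div_eq_inv_mul]
  congr 1
  have e : ∀ i : ℕ, {v : ℝ | (i + 1 : ℝ) ≤ 2 ^ m * v}.indicator (fun _ => (1 : ℝ)) y =
      if i < ⌊2 ^ m * y⌋₊ then 1 else 0 := fun i => by
    rw [indicator_apply]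
    refine if_congr ?_ rfl rfl
    rw [mem_ofPred_eq, ← Nat.succ_le_iff, Nat.le_floor_iff' i.succ_ne_zero]
    push_cast
    rfl
  simp only [e]
  rw [Finset.sum_ite, Finset.sum_const_zero, add_zero, Finset.sum_const, nsmul_one]
  congr 1
  rw [← Finset.card_range (min (m * 2 ^ m) _)]
  congr 1
  ext i
  simp

/-- The nonempty proper upper sets of an interval are its rays. -/
theorem ElemAt.indicator [hI : OrdConnected I] {w : ℕ → I → ℝ} {k : ℕ} (j : ℕ) {U : Set I}
    (hU : IsUpperSet U) : ElemAt w k 0 j (U.indicator fun _ => 1) := by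
  rcases U.eq_empty_or_nonempty with rfl | ⟨b, hb⟩
  · rw [indicator_empty]
    exact ElemAt.const _ _ fun _ => le_rfl
  by_cases hall : ∀ a, a ∈ U
  · rw [eq_univ_of_forall hall, indicator_univ]
    exact ElemAt.const _ _ fun _ => zero_le_one
  obtain ⟨a, ha⟩ := not_forall.1 hall
  have hlb : ∀ u ∈ U, a ≤ u := fun u hu => le_of_not_ge fun h => ha (hU h hu)
  have hbdd : BddBelow (Subtype.val '' U) := ⟨a, by rintro _ ⟨u, hu, rfl⟩; exact hlb u hu⟩
  have hne : (Subtype.val '' U).Nonempty := ⟨b, b, hb, rfl⟩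
  have htI : sInf (Subtype.val '' U) ∈ I := hI.out a.2 b.2
    ⟨le_csInf hne (by rintro _ ⟨u, hu, rfl⟩; exact hlb u hu), csInf_le hbdd ⟨b, hb, rfl⟩⟩
  set t : I := ⟨sInf (Subtype.val '' U), htI⟩
  have h1 : ∀ u ∈ U, t ≤ u := fun u hu => csInf_le hbdd ⟨u, hu, rfl⟩
  have h2 : ∀ u, t < u → u ∈ U := fun u hu => by
    obtain ⟨_, ⟨v, hv, rfl⟩, hvu⟩ := exists_lt_of_csInf_lt hne (show sInf _ < (u : ℝ) from hu)
    exact hU hvu.le hv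
  by_cases htU : t ∈ U
  · have : U = Ici t := Subset.antisymm h1 fun u hu => hU hu htU
    rw [this]
    exact ElemAt.trunc 0 j t
  · have : U = Ioi t := Subset.antisymm
      (fun u hu => lt_of_le_of_ne (h1 u hu) fun h => htU (h ▸ hu)) h2
    rw [this]
    exact ElemAt.ray j t

theorem ElemAt.sum {w : ℕ → I → ℝ} {k d j : ℕ} (s : Finset ℕ) {φ : ℕ → I → ℝ}
    (h : ∀ i ∈ s, ElemAt w k d j (φ i)) : ElemAt w k d j (∑ i ∈ s, φ i) :=
  Finset.sum_induction φ (ElemAt w k d j) (fun _ _ => ElemAt.add)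
    (ElemAt.const _ _ fun _ => le_rfl) h

theorem ElemAt.dyadic_comp [OrdConnected I] {w : ℕ → I → ℝ} {k : ℕ} (j m : ℕ) {g : I → ℝ}
    (hg : Monotone g) : ElemAt w k 0 j fun x => dyadic m (g x) := by
  have e : (fun x => dyadic m (g x)) = ∑ i ∈ Finset.range (m * 2 ^ m),
      (2 ^ m : ℝ)⁻¹ • {x | (i + 1 : ℝ) ≤ 2 ^ m * g x}.indicator fun _ => (1 : ℝ) := by
    funext x
    rw [dyadic_eq_sum, Finset.sum_apply]
    rfl
  rw [e]
  refine ElemAt.sum _ fun i _ => (ElemAt.indicator j fun x y hxy hx => ?_).smul (by positivity)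
  rw [mem_ofPred_eq] at hx ⊢
  exact hx.trans (mul_le_mul_of_nonneg_left (hg hxy) (by positivity))

theorem ElemAt.neg_dyadic_comp_neg [OrdConnected I] {w : ℕ → I → ℝ} {k j : ℕ} (hj : j < k)
    (m : ℕ) {g : I → ℝ} (hg : Monotone g) : ElemAt w k 0 j fun x => -dyadic m (-g x) := by
  -- the negative of the indicator of a lower set is that of its complement, minus `1`
  have e : (fun x => -dyadic m (-g x)) = ∑ i ∈ Finset.range (m * 2 ^ m),
      (2 ^ m : ℝ)⁻¹ • (({x | (i + 1 : ℝ) ≤ 2 ^ m * -g x}ᶜ.indicator fun _ => (1 : ℝ)) +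
        fun _ => (-1 : ℝ)) := by
    funext x
    rw [dyadic_eq_sum, Finset.sum_apply, ← Finset.sum_neg_distrib]
    refine Finset.sum_congr rfl fun i _ => ?_
    by_cases h : (i + 1 : ℝ) ≤ 2 ^ m * -g x
    · have h1 : x ∉ {x | (i + 1 : ℝ) ≤ 2 ^ m * -g x}ᶜ := fun h' => h' h
      rw [indicator_of_mem (by exact h), Pi.smul_apply, Pi.add_apply, indicator_of_notMem h1]
      simp
    · have h1 : x ∈ {x | (i + 1 : ℝ) ≤ 2 ^ m * -g x}ᶜ := h
      rw [indicator_of_notMem (by exact h), Pi.smul_apply, Pi.add_apply, indicator_of_mem h1]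
      simp
  rw [e]
  refine ElemAt.sum _ fun i _ => ((ElemAt.indicator j fun x y hxy => ?_).add
    (ElemAt.const _ _ fun h => absurd hj h.not_gt)).smul (by positivity)
  simp only [mem_compl_iff, mem_ofPred_eq]
  exact fun hx hy => hx (hy.trans <|
    mul_le_mul_of_nonneg_left (neg_le_neg (hg hxy)) (by positivity))

/-! ### Monotone approximation by elementary functions -/

/-- To the right of `z` one has `0 ≤ φ ≤ ψ`, and to the left of `z` the same with `ε φ`, `ε ψ`
in place of `φ`, `ψ`. -/
def SignedLE (z : I) (ε : ℝ) (φ ψ : I → ℝ) : Prop :=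
  (∀ x, z ≤ x → 0 ≤ φ x ∧ φ x ≤ ψ x) ∧ ∀ x, x ≤ z → 0 ≤ ε * φ x ∧ ε * φ x ≤ ε * ψ x

/-- The function `g` is the pointwise limit of elementary functions that increase in absolute
value, all with the sign pattern of `SignedLE z ε`. -/
def Approx (w : ℕ → I → ℝ) (k : ℕ) (z : I) (ε : ℝ) (d j : ℕ) (g : I → ℝ) : Prop :=
  ∃ s : ℕ → I → ℝ, (∀ m, ElemAt w k d j (s m)) ∧ (∀ m, SignedLE z ε (s m) (s (m + 1))) ∧
    (∀ m, SignedLE z ε (s m) g) ∧ ∀ x, Tendsto (fun m => s m x) atTop (𝓝 (g x))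

section

variable {w : ℕ → I → ℝ} {k d j : ℕ} {z : I} {ε : ℝ} {φ ψ g v : I → ℝ}

theorem signedLE_one_iff : SignedLE z 1 φ ψ ↔ 0 ≤ φ ∧ φ ≤ ψ := by
  simp only [SignedLE, one_mul]
  refine ⟨fun h => ?_, fun h => ⟨fun x _ => ⟨h.1 x, h.2 x⟩, fun x _ => ⟨h.1 x, h.2 x⟩⟩⟩
  have h' : ∀ x, 0 ≤ φ x ∧ φ x ≤ ψ x := fun x => (le_total z x).elim (h.1 x) (h.2 x)
  exact ⟨fun x => (h' x).1, fun x => (h' x).2⟩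

theorem SignedLE.abs_le (h : SignedLE z ε φ ψ) (hε : ε ≠ 0) (x : I) : |φ x| ≤ |ψ x| := by
  rcases le_total z x with hx | hx
  · obtain ⟨h1, h2⟩ := h.1 x hx
    exact abs_le_abs_of_nonneg h1 h2
  · obtain ⟨h1, h2⟩ := h.2 x hx
    have := abs_le_abs_of_nonneg h1 h2
    rw [abs_mul, abs_mul] at this
    exact le_of_mul_le_mul_left this (abs_pos.2 hε)

theorem SignedLE.primitive [hI : OrdConnected I] (h : SignedLE z ε φ ψ) (hφ : LocBdd φ)
    (hψ : LocBdd ψ) (hv : LocBdd v) (hpos : ∀ x, 0 < v x) :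
    SignedLE z (-ε) (GaugedCone.primitive z v φ) (GaugedCone.primitive z v ψ) := by
  have hi := (hφ.mul hv).intervalIntegrable
  have hi' := (hψ.mul hv).intervalIntegrable
  refine ⟨fun x hx => ⟨?_, ?_⟩, fun x hx => ?_⟩
  · refine intervalIntegral.integral_nonneg hx fun u hu => ext_nonneg fun huI => ?_
    exact mul_nonneg (h.1 _ hu.1).1 (hpos _).le
  · refine intervalIntegral.integral_mono_on hx (hi z x) (hi' z x) fun u hu =>
      ext_le_ext fun huI => ?_
    exact mul_le_mul_of_nonneg_right (h.1 _ hu.1).2 (hpos _).le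
  · have e : ∀ f : I → ℝ, -ε * GaugedCone.primitive z v f x =
        ∫ u in (x : ℝ)..z, ext (ε • (f * v)) u := fun f => by
      rw [ext_smul, GaugedCone.primitive, intervalIntegral.integral_symm]
      simp [intervalIntegral.integral_const_mul]
    rw [e, e]
    constructor
    · refine intervalIntegral.integral_nonneg hx fun u hu => ext_nonneg fun huI => ?_
      simp only [Pi.smul_apply, Pi.mul_apply, smul_eq_mul, ← mul_assoc]
      exact mul_nonneg (h.2 ⟨u, huI⟩ hu.2).1 (hpos _).le
    · refine intervalIntegral.integral_mono_on hx (((hφ.mul hv).smul ε).intervalIntegrable x z)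
        (((hψ.mul hv).smul ε).intervalIntegrable x z) fun u hu => ext_le_ext fun huI => ?_
      simp only [Pi.smul_apply, Pi.mul_apply, smul_eq_mul, ← mul_assoc]
      exact mul_le_mul_of_nonneg_right (h.2 ⟨u, huI⟩ hu.2).2 (hpos _).le

theorem tendsto_ext_mul {s : ℕ → I → ℝ} (h : ∀ x, Tendsto (fun m => s m x) atTop (𝓝 (g x)))
    (u : ℝ) : Tendsto (fun m => ext (s m * v) u) atTop (𝓝 (ext (g * v) u)) := by
  by_cases hu : u ∈ I
  · simp only [ext_apply_mem _ hu, Pi.mul_apply]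
    exact (h _).mul_const _
  · simp only [ext_apply_notMem _ hu]
    exact tendsto_const_nhds

theorem abs_ext_mul_le (h : ∀ x, |φ x| ≤ |ψ x|) (u : ℝ) :
    ‖ext (φ * v) u‖ ≤ ‖ext (ψ * v) u‖ := by
  by_cases hu : u ∈ I
  · simp only [ext_apply_mem _ hu, Pi.mul_apply, norm_mul, Real.norm_eq_abs]
    exact mul_le_mul_of_nonneg_right (h _) (abs_nonneg _)
  · simp [ext_apply_notMem _ hu]

theorem Approx.primitive [OrdConnected I] (hw : IsGauge w) (hε : ε ≠ 0) (hj : j < k)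
    (hg : LocBdd g) (h : Approx w k z ε d (j + 1) g) :
    Approx w k z (-ε) (d + 1) j (GaugedCone.primitive z (w (j + 1)) g) := by
  obtain ⟨s, h1, h2, h3, h4⟩ := h
  have hb := fun m => (h1 m).locBdd hw
  refine ⟨fun m => GaugedCone.primitive z (w (j + 1)) (s m),
    fun m => (h1 m).primitive hw z rfl hj,
    fun m => (h2 m).primitive (hb m) (hb _) (hw.locBdd _) (hw.pos _),
    fun m => (h3 m).primitive (hb m) hg (hw.locBdd _) (hw.pos _), fun x => ?_⟩
  refine intervalIntegral.tendsto_integral_filter_of_dominated_convergence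
    (fun u => ‖ext (g * w (j + 1)) u‖)
    (Eventually.of_forall fun m =>
      (measurable_ext ((hb m).mul (hw.locBdd (j + 1))).1).aestronglyMeasurable)
    (Eventually.of_forall fun m => Eventually.of_forall fun u _ =>
      abs_ext_mul_le ((h3 m).abs_le hε) u)
    ((hg.mul (hw.locBdd (j + 1))).intervalIntegrable z x).norm
    (Eventually.of_forall fun u _ => tendsto_ext_mul h4 u)

theorem Approx.const_add_lowerPrimitive [OrdConnected I] (hw : IsGauge w) (hj : k ≤ j)
    (h : Approx w k z 1 d (j + 1) g) {c : ℝ} (hc : 0 ≤ c)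
    (hi : ∀ x : I, IntegrableOn (ext (g * w (j + 1))) (Iic (x : ℝ))) :
    Approx w k z 1 (d + 1) j ((fun _ => c) + lowerPrimitive (w (j + 1)) g) := by
  obtain ⟨s, h1, h2, h3, h4⟩ := h
  have hm : ∀ m, Measurable (ext (s m * w (j + 1))) := fun m =>
    measurable_ext (((h1 m).locBdd hw).mul (hw.locBdd _)).1
  have hle : ∀ m u, ‖ext (s m * w (j + 1)) u‖ ≤ ‖ext (g * w (j + 1)) u‖ := fun m u =>
    abs_ext_mul_le ((h3 m).abs_le one_ne_zero) u
  have his : ∀ m, ∀ x : I, IntegrableOn (ext (s m * w (j + 1))) (Iic (x : ℝ)) := fun m x =>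
    Integrable.mono (hi x) (hm m).aestronglyMeasurable (Eventually.of_forall (hle m))
  have hmono : ∀ {φ ψ : I → ℝ}, φ ≤ ψ →
      (∀ x : I, IntegrableOn (ext (φ * w (j + 1))) (Iic (x : ℝ))) →
      (∀ x : I, IntegrableOn (ext (ψ * w (j + 1))) (Iic (x : ℝ))) →
      (fun _ => c) + lowerPrimitive (w (j + 1)) φ ≤
        (fun _ => c) + lowerPrimitive (w (j + 1)) ψ := by
    intro φ ψ h hφ hψ x
    refine add_le_add_right (setIntegral_mono (hφ x) (hψ x) fun u => ext_le_ext fun _ => ?_) c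
    exact mul_le_mul_of_nonneg_right (h _) (hw.pos _ _).le
  have hel : ∀ m, ElemAt w k (d + 1) j ((fun _ => c) + lowerPrimitive (w (j + 1)) (s m)) :=
    fun m => (ElemAt.const _ _ fun _ => hc).add ((h1 m).lowerPrimitive hw rfl hj (his m))
  refine ⟨fun m => (fun _ => c) + lowerPrimitive (w (j + 1)) (s m), hel, fun m => ?_, fun m => ?_,
    fun x => ?_⟩
  · exact signedLE_one_iff.2 ⟨(hel m).nonneg hw hj,
      hmono (signedLE_one_iff.1 (h2 m)).2 (his m) (his _)⟩
  · exact signedLE_one_iff.2 ⟨(hel m).nonneg hw hj,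
      hmono (signedLE_one_iff.1 (h3 m)).2 (his m) hi⟩
  · exact (tendsto_integral_of_dominated_convergence _
      (fun m => (hm m).aestronglyMeasurable) (hi x).norm
      (fun m => Eventually.of_forall (hle m))
      (Eventually.of_forall (tendsto_ext_mul h4))).const_add c

theorem Approx.of_monotone_of_nonneg [OrdConnected I] (hg : Monotone g) (h0 : 0 ≤ g) :
    Approx w k z 1 0 j g :=
  ⟨fun m x => dyadic m (g x), fun m => ElemAt.dyadic_comp j m hg,
    fun _ => signedLE_one_iff.2 ⟨fun _ => dyadic_nonneg _ _, fun _ => dyadic_le_succ _ _⟩,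
    fun _ => signedLE_one_iff.2 ⟨fun _ => dyadic_nonneg _ _, fun x => dyadic_le _ (h0 x)⟩,
    fun x => tendsto_dyadic (h0 x)⟩

theorem Approx.of_monotone_of_eq_zero [OrdConnected I] (hj : j < k) (hg : Monotone g)
    (h0 : g z = 0) : Approx w k z (-1) 0 j g := by
  have hr : ∀ x, z ≤ x → 0 ≤ g x := fun x hx => h0 ▸ hg hx
  have hl : ∀ x, x ≤ z → g x ≤ 0 := fun x hx => h0 ▸ hg hx
  refine ⟨fun m => (fun x => dyadic m (g x)) + fun x => -dyadic m (-g x),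
    fun m => (ElemAt.dyadic_comp j m hg).add (ElemAt.neg_dyadic_comp_neg hj m hg),
    fun m => ⟨fun x hx => ?_, fun x hx => ?_⟩, fun m => ⟨fun x hx => ?_, fun x hx => ?_⟩,
    fun x => ?_⟩
  · have := neg_nonpos.2 (hr x hx)
    simp [dyadic_of_nonpos _ this, dyadic_nonneg, dyadic_le_succ]
  · simp [dyadic_of_nonpos _ (hl x hx), dyadic_nonneg, dyadic_le_succ]
  · have := neg_nonpos.2 (hr x hx)
    simp [dyadic_of_nonpos _ this, dyadic_nonneg, dyadic_le _ (hr x hx)]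
  · have := neg_nonneg.2 (hl x hx)
    simp [dyadic_of_nonpos _ (hl x hx), dyadic_nonneg, dyadic_le _ this]
  · rcases le_total z x with hx | hx
    · have := neg_nonpos.2 (hr x hx)
      simpa [dyadic_of_nonpos _ this] using tendsto_dyadic (hr x hx)
    · have := neg_nonneg.2 (hl x hx)
      simpa [dyadic_of_nonpos _ (hl x hx)] using (tendsto_dyadic this).neg

end

/-! ### Gauged derivatives of polynomials and of generalized monotone functions -/

section

variable {w : ℕ → I → ℝ} {k n : ℕ} {f g v ψ : I → ℝ}

theorem dom_subset {i j : ℕ} (h : i ≤ j) : dom w j ⊆ dom w i := by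
  induction h with
  | refl => exact Subset.rfl
  | step _ ih => exact Subset.trans (fun f hf => hf.1) ih

theorem gDeriv_zero_mul (hw : IsGauge w) (f : I → ℝ) : w 0 * gDeriv w 0 f = f :=
  funext fun x => mul_div_cancel₀ _ (hw.pos 0 x).ne'

theorem gDeriv_zero_mul_left (hw : IsGauge w) (f : I → ℝ) : gDeriv w 0 (w 0 * f) = f :=
  funext fun x => mul_div_cancel_left₀ _ (hw.pos 0 x).ne'

theorem hasGenDeriv_gDeriv (hw : IsGauge w) {j : ℕ} (hf : f ∈ dom w (j + 1)) :
    HasGenDeriv (w (j + 1)) (gDeriv w j f) (gDeriv w (j + 1) f * w (j + 1)) := by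
  have hex := hf.2.2
  have e : gDeriv w (j + 1) f * w (j + 1) = hex.choose := by
    have : genD (w (j + 1)) (gDeriv w j f) = hex.choose := by rw [genD, dif_pos hex]
    rw [← this]
    exact funext fun x => div_mul_cancel₀ _ (hw.pos _ x).ne'
  rw [e]
  exact hex.choose_spec

theorem HasGenDeriv.isPrimitive (h : HasGenDeriv v ψ (f * v)) : IsPrimitive v f ψ :=
  h.eq_add_integral

theorem HasGenDeriv.continuous [OrdConnected I] (h : HasGenDeriv v ψ (f * v)) : Continuous ψ :=
  h.isPrimitive.continuous h.intervalIntegrable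

/-- A one-sided continuous function that is negative at a point is negative on an interval, so
that its primitive decreases there. -/
theorem HasGenDeriv.nonneg_of_monotone (hI : I.OrdConnected) (hI' : I.Nontrivial)
    (hv : ∀ x, 0 < v x) (h : HasGenDeriv v ψ g) (hψ : Monotone ψ) : 0 ≤ g := by
  intro x
  by_contra hlt
  have : OrdConnected I := hI
  have : Nontrivial I := hI'.coe_sort
  have hd : (g / v) x < 0 := div_neg_of_neg_of_pos (not_le.1 hlt) (hv x)
  obtain ⟨y, z, hyz, hneg⟩ : ∃ y z : I, y < z ∧ ∀ u : I, y < u → u < z → (g / v) u < 0 := by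
    by_cases hx : IsMax x
    · obtain ⟨y₀, hy₀⟩ := exists_ne x
      have hy₀x : y₀ < x := lt_of_le_of_ne (not_lt.1 fun hlt' => hx.not_lt hlt') hy₀
      obtain ⟨y, hy, hsub⟩ := (mem_nhdsLE_iff_exists_Ioc_subset' hy₀x).1
        ((h.mem_LD.2 x hx).eventually (gt_mem_nhds hd))
      exact ⟨y, x, hy, fun u h1 h2 => hsub ⟨h1, h2.le⟩⟩
    · obtain ⟨y₀, hy₀⟩ := not_isMax_iff.1 hx
      obtain ⟨y, hy, hsub⟩ := (mem_nhdsGE_iff_exists_Ico_subset' hy₀).1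
        ((h.mem_LD.1 x hx).eventually (gt_mem_nhds hd))
      exact ⟨x, y, hy, fun u h1 h2 => hsub ⟨h1.le, h2⟩⟩
  have hp : 0 < ∫ u in (y : ℝ)..z, -ext g u := by
    refine intervalIntegral.intervalIntegral_pos_of_pos_on
      (h.intervalIntegrable y z).neg (fun u hu => ?_) hyz
    have huI : u ∈ I := hI.out y.2 z.2 ⟨hu.1.le, hu.2.le⟩
    have h2 := (div_neg_iff.1 (hneg ⟨u, huI⟩ hu.1 hu.2)).resolve_left
      fun h' => (hv _).not_gt h'.2
    simpa [ext, huI] using h2.1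
  rw [intervalIntegral.integral_neg] at hp
  have e1 := h.eq_add_integral y z
  have e2 := hψ hyz.le
  linarith

theorem mem_LD_of_continuous (h : Continuous f) : f ∈ (LD : Set (I → ℝ)) :=
  ⟨fun _ _ => h.continuousWithinAt, fun _ _ => h.continuousWithinAt⟩

theorem IsPrimitive.hasGenDeriv [OrdConnected I] (hv : LocBdd v) (hpos : ∀ x, 0 < v x)
    (hf : Continuous f) (h : IsPrimitive v f ψ) : HasGenDeriv v ψ (f * v) where
  measurable := hf.measurable.mul hv.1
  mem_LD := by
    have e : f * v / v = f := funext fun x => mul_div_cancel_right₀ _ (hpos x).ne'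
    rw [e]
    exact mem_LD_of_continuous hf
  intervalIntegrable := ((LocBdd.of_continuous hf).mul hv).intervalIntegrable
  eq_add_integral := h

theorem gDeriv_succ_eq (hI : I.OrdConnected) (hI' : I.Nontrivial) (hw : IsGauge w) {j : ℕ}
    (h : HasGenDeriv (w (j + 1)) (gDeriv w j f) (g * w (j + 1))) : gDeriv w (j + 1) f = g := by
  rw [gDeriv, h.genD_eq hI hI' (hw.pos _)]
  exact funext fun x => mul_div_cancel_right₀ _ (hw.pos _ x).ne'

theorem PolyAt.mem_polyCone (hI : I.OrdConnected) (hI' : I.Nontrivial) (hw : IsGauge w)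
    {q : I → ℝ} (h : PolyAt w k n 0 q) : w 0 * q ∈ polyCone w k n := by
  have : OrdConnected I := hI
  have key : ∀ d j, j + d = n → w 0 * q ∈ dom w j ∧ PolyAt w k d j (gDeriv w j (w 0 * q)) := by
    intro d j hjd
    induction j generalizing d with
    | zero =>
      obtain rfl : d = n := by omega
      rw [gDeriv_zero_mul_left hw]
      exact ⟨(hw.measurable 0).mul (h.continuous hw).measurable, h⟩
    | succ j ih =>
      obtain ⟨h1, h2⟩ := ih (d + 1) (by omega)
      have hc := h2.continuous hw
      obtain ⟨-, q', hq', hp⟩ := h2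
      have hd := hp.hasGenDeriv (hw.locBdd _) (hw.pos _) (hq'.continuous hw)
      rw [gDeriv_succ_eq hI hI' hw hd]
      exact ⟨⟨h1, hc.measurable, _, hd⟩, hq'⟩
  refine ⟨?_, (key 0 n rfl).1, fun j hk hj => ?_⟩
  · obtain ⟨h1, -, c, hc⟩ := key 0 n rfl
    have hd : HasGenDeriv (w (n + 1)) (gDeriv w n (w 0 * q)) ((fun _ => 0) * w (n + 1)) := by
      rw [hc]
      exact (IsPrimitive.const _ c).hasGenDeriv (hw.locBdd _) (hw.pos _) continuous_const
    refine ⟨⟨h1, ?_, _, hd⟩, gDeriv_succ_eq hI hI' hw hd⟩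
    rw [hc]
    exact measurable_const
  · exact (key (n - j) j (by omega)).2.monotone hw hk

/-- Below the order `k` there is no sign condition, so that multiples of a polynomial of degree
at most `k - 1` by arbitrary constants are in the cone. -/
theorem smul_mem_polyCone_of_mem_polyLE (hI : I.OrdConnected) (hI' : I.Nontrivial)
    (hw : IsGauge w) (hk : 1 ≤ k) (hkn : k ≤ n + 1) {p : I → ℝ} (hp : p ∈ polyLE w (k - 1))
    (c : ℝ) : c • p ∈ polyCone w k n := by
  have : OrdConnected I := hI
  obtain ⟨z, hz⟩ := hI'.nonempty
  have key : ∀ e j d, j + e + 1 = k → j + d = n → PolyAt w k d j (c • gDeriv w j p) := by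
    intro e
    induction e with
    | zero =>
      intro j d hje _
      obtain rfl : j = k - 1 := by omega
      have hd := (hasGenDeriv_gDeriv hw hp.1).isPrimitive
      rw [hp.2] at hd
      have e : c • gDeriv w (k - 1) p = fun _ => c * gDeriv w (k - 1) p ⟨z, hz⟩ := by
        funext x
        have h0 := (IsPrimitive.const (w (k - 1 + 1)) 0) ⟨z, hz⟩ x
        have h1 := hd ⟨z, hz⟩ x
        rw [zero_add] at h0
        rw [Pi.smul_apply, smul_eq_mul, h1]
        exact congrArg (c * ·) ((congrArg (_ + ·) h0.symm).trans (add_zero _))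
      rw [e]
      exact PolyAt.const w _ _ fun h => by omega
    | succ e ih =>
      intro j d hje hjd
      obtain ⟨d, rfl⟩ : ∃ d', d = d' + 1 := ⟨d - 1, by omega⟩
      have hd := hasGenDeriv_gDeriv hw
        (dom_subset (show j + 1 ≤ k - 1 + 1 by omega) hp.1)
      exact ⟨fun h => by omega, _, ih (j + 1) d (by omega) (by omega), hd.isPrimitive.smul c⟩
  have h0 := (key (k - 1) 0 n (by omega) (by omega)).mem_polyCone hI hI' hw
  rwa [mul_smul_comm, gDeriv_zero_mul hw] at h0

theorem coneF.locBdd_gDeriv [OrdConnected I] (hw : IsGauge w) (hkn : k ≤ n + 1)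
    (hf : f ∈ coneF w k n) {j : ℕ} (hj : j ≤ n) : LocBdd (gDeriv w j f) := by
  rcases hj.eq_or_lt with rfl | hj
  · exact LocBdd.of_monotone (hf.2 j hkn le_rfl)
  · exact LocBdd.of_continuous (hasGenDeriv_gDeriv hw (dom_subset hj hf.1)).continuous

theorem coneF.gDeriv_nonneg (hI : I.OrdConnected) (hI' : I.Nontrivial) (hw : IsGauge w)
    (hk : 1 ≤ k) (hf : f ∈ coneF w k n) {j : ℕ} (hkj : k ≤ j) (hj : j ≤ n) :
    0 ≤ gDeriv w j f := by
  obtain ⟨j, rfl⟩ : ∃ i, j = i + 1 := ⟨j - 1, by omega⟩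
  have h := (hasGenDeriv_gDeriv hw (dom_subset hj hf.1)).nonneg_of_monotone hI hI' (hw.pos _)
    (hf.2 j (by omega) (by omega))
  exact fun x => nonneg_of_mul_nonneg_left (h x) (hw.pos _ x)

/-- The gauged derivatives of order at least `k` are nonnegative and nondecreasing, hence they
are recovered from their infima by integration from the left endpoint. -/
theorem coneF.approx_of_le (hI : I.OrdConnected) (hI' : I.Nontrivial) (hw : IsGauge w)
    (hk : 1 ≤ k) (hf : f ∈ coneF w k n) (z : I) (d j : ℕ) (hjd : j + d = n)
    (hkj : k ≤ j) : Approx w k z 1 d j (gDeriv w j f) := by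
  have : OrdConnected I := hI
  have : Nonempty I := ⟨z⟩
  induction d generalizing j with
  | zero =>
    exact Approx.of_monotone_of_nonneg (hf.2 j (by omega) (by omega))
      (coneF.gDeriv_nonneg hI hI' hw hk hf hkj (by omega))
  | succ d ih =>
    have hd := hasGenDeriv_gDeriv hw (dom_subset (show j + 1 ≤ n by omega) hf.1)
    have h0 := coneF.gDeriv_nonneg hI hI' hw hk hf hkj (by omega)
    obtain ⟨h1, h2⟩ := hd.isPrimitive.eq_iInf_add_lowerPrimitive hd.intervalIntegrable
      (coneF.gDeriv_nonneg hI hI' hw hk hf (by omega) (by omega)) (hw.pos _)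
      ⟨0, by rintro _ ⟨x, rfl⟩; exact h0 x⟩
    rw [h2]
    exact (ih (j + 1) (by omega) (by omega)).const_add_lowerPrimitive hw hkj
      (le_ciInf h0) h1

/-- Below the order `k`, the gauged derivatives are approximated after subtraction of their
Taylor polynomials at `z`. -/
theorem coneF.exists_approx (hI : I.OrdConnected) (hI' : I.Nontrivial) (hw : IsGauge w)
    (hk : 1 ≤ k) (hkn : k ≤ n + 1) (hf : f ∈ coneF w k n) (z : I) (e j d : ℕ)
    (hje : j + e + 1 = k) (hjd : j + d = n) :
    ∃ (ε : ℝ) (g T : I → ℝ), (ε = 1 ∨ ε = -1) ∧ Approx w k z ε d j g ∧ PolyAt w k e j T ∧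
      gDeriv w j f = g + T := by
  have : OrdConnected I := hI
  induction e generalizing j d with
  | zero =>
    have hmono := hf.2 j (by omega) (by omega)
    refine ⟨-1, (fun _ => -gDeriv w j f z) + gDeriv w j f, fun _ => gDeriv w j f z, Or.inr rfl, ?_,
      PolyAt.const w _ _ fun h => by omega, ?_⟩
    · cases d with
      | zero =>
        exact Approx.of_monotone_of_eq_zero (by omega) (fun x y h => add_le_add_right (hmono h) _)
          (neg_add_cancel _)
      | succ d =>
        have hd := (hasGenDeriv_gDeriv hw (dom_subset (show j + 1 ≤ n by omega) hf.1)).isPrimitive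
        have h1 := (coneF.approx_of_le hI hI' hw hk hf z d (j + 1) (by omega)
          (by omega)).primitive hw one_ne_zero (by omega)
          (coneF.locBdd_gDeriv hw hkn hf (by omega))
        convert! h1 using 1
        funext x
        simp only [Pi.add_apply]
        rw [hd z x, neg_add_cancel_left]
        rfl
    · funext x
      simp
  | succ e ih =>
    obtain ⟨d, rfl⟩ : ∃ d', d = d' + 1 := ⟨d - 1, by omega⟩
    obtain ⟨ε, g, T, hε, h1, h2, h3⟩ := ih (j + 1) d (by omega) (by omega)
    have hε0 : ε ≠ 0 := by rcases hε with rfl | rfl <;> norm_num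
    have hT := h2.locBdd hw
    have hg : LocBdd g := by
      have := (coneF.locBdd_gDeriv hw hkn hf (show j + 1 ≤ n by omega)).sub hT
      rwa [h3, add_sub_cancel_right] at this
    have hd := (hasGenDeriv_gDeriv hw (dom_subset (show j + 1 ≤ n by omega) hf.1)).isPrimitive
    refine ⟨-ε, primitive z (w (j + 1)) g,
      (fun _ => gDeriv w j f z) + primitive z (w (j + 1)) T, ?_,
      h1.primitive hw hε0 (by omega) hg, ⟨fun h => by omega, T, h2, ?_⟩, ?_⟩
    · rcases hε with rfl | rfl <;> simp
    · exact (isPrimitive_primitive (hT.mul (hw.locBdd _)).intervalIntegrable z).const_add _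
    · have h4 := hd.eq_add_primitive z
      rw [h3, primitive_add hg hT (hw.locBdd _)] at h4
      rw [h4]
      funext x
      simp only [Pi.add_apply, primitive_self]
      ring

end

/-! ### Integrals with values in the extended reals -/

section

variable {ν ν₁ ν₂ : Measure I} {f g : I → ℝ}

theorem coe_ennreal_sub_coe_ennreal_le_iff {a b c d : ℝ≥0∞} (hb : b ≠ ∞) (hd : d ≠ ∞) :
    (c : EReal) - d ≤ (a : EReal) - b ↔ c + b ≤ a + d := by
  lift b to NNReal using hb
  lift d to NNReal using hd
  induction a with
  | top => simp
  | coe a =>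
    induction c with
    | top =>
      simp only [EReal.coe_ennreal_top, top_add, top_le_iff]
      constructor
      · intro h
        exact absurd h (by
          rw [not_le]
          exact lt_of_lt_of_le (EReal.coe_lt_top ((a : ℝ) - b)) (by rfl))
      · intro h
        exact absurd h (by simp)
    | coe c =>
      have e : ((c : EReal) - (d : EReal) ≤ (a : EReal) - (b : EReal)) ↔
          ((c : ℝ) - d ≤ (a : ℝ) - b) := by
        rw [← EReal.coe_le_coe_iff]
        rfl
      refine Iff.trans e ?_
      rw [sub_le_sub_iff]
      norm_cast

/-- A form of `p - q = (a - b) + (c - d)` that makes sense for infinite values. -/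
theorem coe_ennreal_sub_eq_add {a b c d p q : ℝ≥0∞} (h : p + b + d = q + a + c) (hc : c ≠ ∞)
    (hd : d ≠ ∞) (hfin : b ≠ ∞ ∧ q ≠ ∞ ∨ a ≠ ∞ ∧ p ≠ ∞) :
    (p : EReal) - q = ((a : EReal) - b) + ((c : EReal) - d) := by
  lift c to NNReal using hc
  lift d to NNReal using hd
  have key : ∀ a b p q : NNReal, p + b + d = q + a + c →
      ((p : ℝ≥0∞) : EReal) - ((q : ℝ≥0∞) : EReal) = (((a : ℝ≥0∞) : EReal) - ((b : ℝ≥0∞) : EReal)) +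
        (((c : ℝ≥0∞) : EReal) - ((d : ℝ≥0∞) : EReal)) := by
    intro a b p q h
    have h' : (p : ℝ) - q = (a - b) + (c - d) := by
      have : (p : ℝ) + b + d = q + a + c := by exact_mod_cast h
      linarith
    exact congrArg (Real.toEReal) h'
  rcases hfin with ⟨hb, hq⟩ | ⟨ha, hp⟩
  · lift b to NNReal using hb
    lift q to NNReal using hq
    induction a with
    | top =>
      have hp : p = ∞ := by
        by_contra hp
        exact ENNReal.add_ne_top.2 ⟨ENNReal.add_ne_top.2 ⟨hp, ENNReal.coe_ne_top⟩,
          ENNReal.coe_ne_top⟩ (h.trans (by simp))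
      rw [hp]
      rfl
    | coe a =>
      have hp : p ≠ ∞ := by
        rintro rfl
        simp only [top_add] at h
        exact absurd h.symm (by simp)
      lift p to NNReal using hp
      exact key a b p q (by exact_mod_cast h)
  · lift a to NNReal using ha
    lift p to NNReal using hp
    induction b with
    | top =>
      have hq : q = ∞ := by
        by_contra hq
        exact ENNReal.add_ne_top.2 ⟨ENNReal.add_ne_top.2 ⟨hq, ENNReal.coe_ne_top⟩,
          ENNReal.coe_ne_top⟩ (h.symm.trans (by simp))
      rw [hq]
      simp
    | coe b =>
      have hq : q ≠ ∞ := by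
        rintro rfl
        simp only [top_add] at h
        exact absurd h (by simp)
      lift q to NNReal using hq
      exact key a b p q (by exact_mod_cast h)

theorem ofReal_add_cancel (a b : ℝ) :
    ENNReal.ofReal (a + b) + ENNReal.ofReal (-a) + ENNReal.ofReal (-b) =
      ENNReal.ofReal (-(a + b)) + ENNReal.ofReal a + ENNReal.ofReal b := by
  have key : ∀ x y z : ℝ, ENNReal.ofReal x + ENNReal.ofReal y + ENNReal.ofReal z =
      ENNReal.ofReal (max x 0 + max y 0 + max z 0) := fun x y z => by
    rw [ENNReal.ofReal_add (by positivity) (by positivity),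
      ENNReal.ofReal_add (by positivity) (by positivity)]
    simp
  rw [key, key]
  congr 1
  have h : ∀ x : ℝ, max x 0 - max (-x) 0 = x := fun x => max_zero_sub_max_neg_zero_eq_self x
  linarith [h a, h b, h (a + b)]

theorem lintegral_ofReal_add (hf : Measurable f) (hg : Measurable g) :
    ∫⁻ x, ENNReal.ofReal ((f + g) x) ∂ν + ∫⁻ x, ENNReal.ofReal (-f x) ∂ν +
        ∫⁻ x, ENNReal.ofReal (-g x) ∂ν =
      ∫⁻ x, ENNReal.ofReal (-(f + g) x) ∂ν + ∫⁻ x, ENNReal.ofReal (f x) ∂ν +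
        ∫⁻ x, ENNReal.ofReal (g x) ∂ν := by
  have hf' : Measurable fun x => ENNReal.ofReal (-f x) := hf.neg.ennreal_ofReal
  have hg' : Measurable fun x => ENNReal.ofReal (-g x) := hg.neg.ennreal_ofReal
  rw [← lintegral_add_right _ hf', ← lintegral_add_right _ hg',
    ← lintegral_add_right _ hf.ennreal_ofReal, ← lintegral_add_right _ hg.ennreal_ofReal]
  exact lintegral_congr fun x => ofReal_add_cancel (f x) (g x)

theorem lintegral_ofReal_add_ne_top (hf : Measurable f)
    (h1 : ∫⁻ x, ENNReal.ofReal (f x) ∂ν ≠ ∞) (h2 : ∫⁻ x, ENNReal.ofReal (g x) ∂ν ≠ ∞) :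
    ∫⁻ x, ENNReal.ofReal ((f + g) x) ∂ν ≠ ∞ := by
  refine ne_top_of_le_ne_top (ENNReal.add_ne_top.2 ⟨h1, h2⟩) ?_
  rw [← lintegral_add_left hf.ennreal_ofReal]
  exact lintegral_mono fun x => ENNReal.ofReal_add_le

theorem lintegral_ofReal_neg_add_ne_top (hf : Measurable f)
    (h1 : ∫⁻ x, ENNReal.ofReal (-f x) ∂ν ≠ ∞) (h2 : ∫⁻ x, ENNReal.ofReal (-g x) ∂ν ≠ ∞) :
    ∫⁻ x, ENNReal.ofReal (-(f + g) x) ∂ν ≠ ∞ := by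
  have := lintegral_ofReal_add_ne_top (f := -f) (g := -g) hf.neg h1 h2
  rwa [← neg_add] at this

/-- Both the positive and the negative part of `f` have a finite integral. -/
def FiniteParts (ν : Measure I) (f : I → ℝ) : Prop :=
  ∫⁻ x, ENNReal.ofReal (f x) ∂ν ≠ ∞ ∧ ∫⁻ x, ENNReal.ofReal (-f x) ∂ν ≠ ∞

theorem extIntegral_add (hf : Measurable f) (hg : Measurable g) (hfe : IntegralExists ν f)
    (hgf : FiniteParts ν g) :
    extIntegral ν (f + g) = extIntegral ν f + extIntegral ν g := by
  refine coe_ennreal_sub_eq_add (lintegral_ofReal_add hf hg) hgf.1 hgf.2 ?_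
  rcases hfe with h | h
  · exact Or.inr ⟨h.ne, lintegral_ofReal_add_ne_top hf h.ne hgf.1⟩
  · exact Or.inl ⟨h.ne, lintegral_ofReal_neg_add_ne_top hf h.ne hgf.2⟩

theorem FiniteParts.of_eq_coe {c : ℝ} (he : IntegralExists ν f)
    (h : extIntegral ν f = (c : EReal)) : FiniteParts ν f := by
  rw [extIntegral] at h
  rcases he with h1 | h1
  · refine ⟨h1.ne, fun h2 => ?_⟩
    rw [h2, EReal.coe_ennreal_top, EReal.sub_top] at h
    exact EReal.bot_ne_coe c h
  · refine ⟨fun h2 => ?_, h1.ne⟩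
    lift ∫⁻ x, ENNReal.ofReal (-f x) ∂ν to NNReal using h1.ne with b
    rw [h2] at h
    exact EReal.top_ne_coe c h

theorem FiniteParts.extIntegral_eq (h : FiniteParts ν f) : ∃ c : ℝ, extIntegral ν f = c := by
  rw [extIntegral]
  refine ⟨(∫⁻ x, ENNReal.ofReal (f x) ∂ν).toReal - (∫⁻ x, ENNReal.ofReal (-f x) ∂ν).toReal, ?_⟩
  rw [EReal.coe_sub, EReal.coe_ennreal_toReal h.1, EReal.coe_ennreal_toReal h.2]

theorem lintegral_neg_ne_top_of_bot_lt (h : IntegralExists ν f ∧ ⊥ < extIntegral ν f) :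
    ∫⁻ x, ENNReal.ofReal (-f x) ∂ν ≠ ∞ := fun h2 => by
  have h3 := h.2
  rw [extIntegral, h2, EReal.coe_ennreal_top, EReal.sub_top] at h3
  exact lt_irrefl _ h3

/-- The relation `ν₂(f) ≤ ν₁(f)` when neither integral is `-∞`, written without subtraction. -/
structure Dominates (ν₁ ν₂ : Measure I) (f : I → ℝ) : Prop where
  measurable : Measurable f
  left_ne_top : ∫⁻ x, ENNReal.ofReal (-f x) ∂ν₁ ≠ ∞
  right_ne_top : ∫⁻ x, ENNReal.ofReal (-f x) ∂ν₂ ≠ ∞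
  le : ∫⁻ x, ENNReal.ofReal (f x) ∂ν₂ + ∫⁻ x, ENNReal.ofReal (-f x) ∂ν₁ ≤
    ∫⁻ x, ENNReal.ofReal (f x) ∂ν₁ + ∫⁻ x, ENNReal.ofReal (-f x) ∂ν₂

theorem Dominates.extIntegral_le (h : Dominates ν₁ ν₂ f) :
    extIntegral ν₂ f ≤ extIntegral ν₁ f :=
  (coe_ennreal_sub_coe_ennreal_le_iff h.left_ne_top h.right_ne_top).2 h.le

theorem Dominates.of_extIntegral_le (hf : Measurable f)
    (h₁ : ∫⁻ x, ENNReal.ofReal (-f x) ∂ν₁ ≠ ∞) (h₂ : ∫⁻ x, ENNReal.ofReal (-f x) ∂ν₂ ≠ ∞)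
    (h : extIntegral ν₂ f ≤ extIntegral ν₁ f) : Dominates ν₁ ν₂ f :=
  ⟨hf, h₁, h₂, (coe_ennreal_sub_coe_ennreal_le_iff h₁ h₂).1 h⟩

theorem Dominates.add (hf : Dominates ν₁ ν₂ f) (hg : Dominates ν₁ ν₂ g) :
    Dominates ν₁ ν₂ (f + g) := by
  refine ⟨hf.1.add hg.1, lintegral_ofReal_neg_add_ne_top hf.1 hf.2 hg.2,
    lintegral_ofReal_neg_add_ne_top hf.1 hf.3 hg.3, ?_⟩
  have e1 := lintegral_ofReal_add (ν := ν₁) hf.1 hg.1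
  have e2 := lintegral_ofReal_add (ν := ν₂) hf.1 hg.1
  have hfin := ENNReal.add_ne_top.2 ⟨ENNReal.add_ne_top.2 ⟨hf.2, hg.2⟩,
    ENNReal.add_ne_top.2 ⟨hf.3, hg.3⟩⟩
  have hle := add_le_add hf.le hg.le
  refine (ENNReal.add_le_add_iff_right hfin).1 ?_
  generalize ∫⁻ x, ENNReal.ofReal ((f + g) x) ∂ν₁ = p₁ at *
  generalize ∫⁻ x, ENNReal.ofReal ((f + g) x) ∂ν₂ = p₂ at *
  generalize ∫⁻ x, ENNReal.ofReal (-(f + g) x) ∂ν₁ = q₁ at *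
  generalize ∫⁻ x, ENNReal.ofReal (-(f + g) x) ∂ν₂ = q₂ at *
  generalize ∫⁻ x, ENNReal.ofReal (-f x) ∂ν₁ = b₁ at *
  generalize ∫⁻ x, ENNReal.ofReal (-f x) ∂ν₂ = b₂ at *
  generalize ∫⁻ x, ENNReal.ofReal (-g x) ∂ν₁ = d₁ at *
  generalize ∫⁻ x, ENNReal.ofReal (-g x) ∂ν₂ = d₂ at *
  generalize ∫⁻ x, ENNReal.ofReal (f x) ∂ν₁ = a₁ at *
  generalize ∫⁻ x, ENNReal.ofReal (f x) ∂ν₂ = a₂ at *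
  generalize ∫⁻ x, ENNReal.ofReal (g x) ∂ν₁ = c₁ at *
  generalize ∫⁻ x, ENNReal.ofReal (g x) ∂ν₂ = c₂ at *
  calc p₂ + q₁ + (b₁ + d₁ + (b₂ + d₂)) = (p₂ + b₂ + d₂) + q₁ + (b₁ + d₁) := by ring
    _ = q₂ + q₁ + (a₂ + b₁ + (c₂ + d₁)) := by rw [e2]; ring
    _ ≤ q₂ + q₁ + (a₁ + b₂ + (c₁ + d₂)) := by gcongr
    _ = (q₁ + a₁ + c₁) + q₂ + (b₂ + d₂) := by ring
    _ = p₁ + q₂ + (b₁ + d₁ + (b₂ + d₂)) := by rw [← e1]; ring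

theorem Dominates.smul (hf : Dominates ν₁ ν₂ f) {c : ℝ} (hc : 0 < c) :
    Dominates ν₁ ν₂ (c • f) := by
  have hp : ∀ ν : Measure I, ∫⁻ x, ENNReal.ofReal ((c • f) x) ∂ν =
      ENNReal.ofReal c * ∫⁻ x, ENNReal.ofReal (f x) ∂ν := fun ν => by
    rw [← lintegral_const_mul _ hf.1.ennreal_ofReal]
    exact lintegral_congr fun x => ENNReal.ofReal_mul hc.le
  have hn : ∀ ν : Measure I, ∫⁻ x, ENNReal.ofReal (-(c • f) x) ∂ν =
      ENNReal.ofReal c * ∫⁻ x, ENNReal.ofReal (-f x) ∂ν := fun ν => by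
    have hf' : Measurable fun x => ENNReal.ofReal (-f x) := hf.1.neg.ennreal_ofReal
    rw [← lintegral_const_mul _ hf']
    refine lintegral_congr fun x => ?_
    rw [← ENNReal.ofReal_mul hc.le, Pi.smul_apply, smul_eq_mul, mul_neg]
  refine ⟨hf.1.const_smul c, ?_, ?_, ?_⟩
  · rw [hn]
    exact ENNReal.mul_ne_top ENNReal.ofReal_ne_top hf.2
  · rw [hn]
    exact ENNReal.mul_ne_top ENNReal.ofReal_ne_top hf.3
  · rw [hp, hp, hn, hn, ← mul_add, ← mul_add]
    exact mul_le_mul_right hf.le _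

theorem tendsto_extIntegral {s : ℕ → I → ℝ} (hs : ∀ m, Measurable (s m))
    (hp : ∀ x, Monotone fun m => ENNReal.ofReal (s m x))
    (hn : ∀ x, Monotone fun m => ENNReal.ofReal (-s m x))
    (hlim : ∀ x, Tendsto (fun m => s m x) atTop (𝓝 (g x))) (hg : IntegralExists ν g) :
    Tendsto (fun m => extIntegral ν (s m)) atTop (𝓝 (extIntegral ν g)) := by
  have h1 : Tendsto (fun m => ∫⁻ x, ENNReal.ofReal (s m x) ∂ν) atTop
      (𝓝 (∫⁻ x, ENNReal.ofReal (g x) ∂ν)) :=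
    lintegral_tendsto_of_tendsto_of_monotone (fun m => (hs m).ennreal_ofReal.aemeasurable)
      (Eventually.of_forall hp) (Eventually.of_forall fun x => ENNReal.tendsto_ofReal (hlim x))
  have h2 : Tendsto (fun m => ∫⁻ x, ENNReal.ofReal (-s m x) ∂ν) atTop
      (𝓝 (∫⁻ x, ENNReal.ofReal (-g x) ∂ν)) :=
    lintegral_tendsto_of_tendsto_of_monotone (fun m => (hs m).neg.ennreal_ofReal.aemeasurable)
      (Eventually.of_forall hn)
      (Eventually.of_forall fun x => ENNReal.tendsto_ofReal (hlim x).neg)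
  have h3 := (continuous_coe_ennreal_ereal.tendsto _).comp h1
  have h4 := (continuous_neg.tendsto _).comp ((continuous_coe_ennreal_ereal.tendsto _).comp h2)
  simp only [extIntegral, sub_eq_add_neg]
  refine (EReal.continuousAt_add (p := (_, _)) ?_ ?_).tendsto.comp (h3.prodMk_nhds h4)
  · rcases hg with h | h
    · exact Or.inl (by simpa using h.ne)
    · exact Or.inr (by simpa using h.ne)
  · exact Or.inl (EReal.coe_ennreal_ne_bot _)

theorem extIntegral_le_of_tendsto {s : ℕ → I → ℝ} (hs : ∀ m, Measurable (s m))
    (hp : ∀ x, Monotone fun m => ENNReal.ofReal (s m x))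
    (hn : ∀ x, Monotone fun m => ENNReal.ofReal (-s m x))
    (hlim : ∀ x, Tendsto (fun m => s m x) atTop (𝓝 (g x)))
    (h₁ : IntegralExists ν₁ g) (h₂ : IntegralExists ν₂ g)
    (hle : ∀ m, extIntegral ν₂ (s m) ≤ extIntegral ν₁ (s m)) :
    extIntegral ν₂ g ≤ extIntegral ν₁ g :=
  le_of_tendsto_of_tendsto' (tendsto_extIntegral hs hp hn hlim h₂)
    (tendsto_extIntegral hs hp hn hlim h₁) hle

end

/-! ### Comparison of the two measures -/

section

variable {ν ν₁ ν₂ : Measure I} {w : ℕ → I → ℝ} {k n : ℕ} {φ f g : I → ℝ}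

theorem SignedLE.monotone_ofReal {z : I} {ε : ℝ} {s : ℕ → I → ℝ} (hε : ε = 1 ∨ ε = -1)
    (h : ∀ m, SignedLE z ε (s m) (s (m + 1))) {a : ℝ} (ha : 0 ≤ a) (x : I) :
    (Monotone fun m => ENNReal.ofReal (a * s m x)) ∧
      Monotone fun m => ENNReal.ofReal (-(a * s m x)) := by
  have key : (∀ m, 0 ≤ s m x ∧ s m x ≤ s (m + 1) x) ∨
      ∀ m, s m x ≤ 0 ∧ s (m + 1) x ≤ s m x := by
    rcases le_total z x with hx | hx
    · exact Or.inl fun m => (h m).1 x hx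
    · rcases hε with rfl | rfl
      · exact Or.inl fun m => by simpa using (h m).2 x hx
      · exact Or.inr fun m => by simpa using (h m).2 x hx
  have hz : ∀ {b : ℝ}, b ≤ 0 → ENNReal.ofReal b = 0 := ENNReal.ofReal_of_nonpos
  rcases key with h | h
  · refine ⟨monotone_nat_of_le_succ fun m =>
      ENNReal.ofReal_le_ofReal (mul_le_mul_of_nonneg_left (h m).2 ha),
      monotone_nat_of_le_succ fun m => ?_⟩
    rw [hz (neg_nonpos.2 (mul_nonneg ha (h m).1))]
    exact zero_le
  · refine ⟨monotone_nat_of_le_succ fun m => ?_, monotone_nat_of_le_succ fun m =>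
      ENNReal.ofReal_le_ofReal (neg_le_neg (mul_le_mul_of_nonneg_left (h m).2 ha))⟩
    rw [hz (mul_nonpos_of_nonneg_of_nonpos ha (h m).1)]
    exact zero_le

/-- For `n = 0`, the indicator of an open ray is an increasing limit of truncated powers. -/
theorem Dominates.ray [OrdConnected I] (hw : IsGauge w)
    (h : ∀ t, Dominates ν₁ ν₂ (pPlus w 0 t)) (t : I) :
    Dominates ν₁ ν₂ (w 0 * (Ioi t).indicator fun _ => 1) := by
  have hm : Measurable (w 0 * (Ioi t).indicator fun _ => 1) :=
    (hw.measurable 0).mul (measurable_const.indicator measurableSet_Ioi)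
  have hneg : ∀ ν : Measure I,
      ∫⁻ x, ENNReal.ofReal (-(w 0 * (Ioi t).indicator (fun _ => 1) : I → ℝ) x) ∂ν = 0 := fun ν => by
    rw [← lintegral_zero (μ := ν)]
    refine lintegral_congr fun x => ENNReal.ofReal_of_nonpos (neg_nonpos.2 ?_)
    exact mul_nonneg (hw.pos 0 x).le (indicator_nonneg (fun _ _ => zero_le_one) x)
  have hex : ∀ ν : Measure I, IntegralExists ν (w 0 * (Ioi t).indicator fun _ => 1) := fun ν =>
    Or.inr (by rw [hneg ν]; exact ENNReal.zero_lt_top)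
  refine Dominates.of_extIntegral_le hm (by rw [hneg]; exact ENNReal.zero_ne_top)
    (by rw [hneg]; exact ENNReal.zero_ne_top) ?_
  by_cases ht : IsMax t
  · have e : (Ioi t).indicator (fun _ => (1 : ℝ)) = fun _ => 0 := by
      rw [ht.Ioi_eq, indicator_empty]
    rw [e]
    simp [extIntegral]
  obtain ⟨b, hb⟩ := not_isMax_iff.1 ht
  obtain ⟨u, hu, hub, hut⟩ := exists_seq_strictAnti_tendsto' hb
  have hmono : ∀ x m, (Ici (u m)).indicator (fun _ => (1 : ℝ)) x ≤
      (Ici (u (m + 1))).indicator (fun _ => 1) x := fun x m =>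
    indicator_le_indicator_of_subset (Ici_subset_Ici.2 (hu m.lt_succ_self).le)
      (fun _ => zero_le_one) x
  have hp : ∀ t, pPlus w 0 t = w 0 * (Ici t).indicator fun _ => 1 := fun t =>
    (mul_truncPow_eq_pPlus w t 0).symm
  have hsg := fun m => signedLE_one_iff (z := t)
    (φ := (Ici (u m)).indicator fun _ => (1 : ℝ))
    (ψ := (Ici (u (m + 1))).indicator fun _ => (1 : ℝ)) |>.2
    ⟨fun x => indicator_nonneg (fun _ _ => zero_le_one) x, fun x => hmono x m⟩
  refine extIntegral_le_of_tendsto (s := fun m => pPlus w 0 (u m)) (fun m => (h _).1)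
    (fun x => ?_) (fun x => ?_) (fun x => ?_) (hex ν₁) (hex ν₂) fun m => (h _).extIntegral_le
  · simp only [hp]
    exact (SignedLE.monotone_ofReal (Or.inl rfl) hsg (hw.pos 0 x).le x).1
  · simp only [hp]
    exact (SignedLE.monotone_ofReal (Or.inl rfl) hsg (hw.pos 0 x).le x).2
  · simp only [hp, Pi.mul_apply]
    refine Tendsto.const_mul _ (tendsto_const_nhds.congr' ?_)
    by_cases hx : t < x
    · filter_upwards [hut.eventually (gt_mem_nhds hx)] with m hm
      rw [indicator_of_mem (by exact hx), indicator_of_mem (by exact hm.le)]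
    · refine Eventually.of_forall fun m => ?_
      have : ¬ u m ≤ x := fun h' => hx ((hub m).1.trans_le h')
      simp [hx, this]

theorem ElemAt.dominates (hI : I.OrdConnected) (hI' : I.Nontrivial) (hw : IsGauge w)
    (hpoly : ∀ p ∈ polyCone w k n, Dominates ν₁ ν₂ p)
    (htrunc : ∀ t, Dominates ν₁ ν₂ (pPlus w n t)) {d j : ℕ} (h : ElemAt w k d j φ) (hd : d = n)
    (hj : j = 0) : Dominates ν₁ ν₂ (w 0 * φ) := by
  have : OrdConnected I := hI
  induction h with
  | poly h =>
    subst hd hj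
    exact hpoly _ (h.mem_polyCone hI hI' hw)
  | trunc d j t =>
    subst hd hj
    rw [mul_truncPow_eq_pPlus]
    exact htrunc t
  | ray j t =>
    subst hd
    exact Dominates.ray hw htrunc t
  | add _ _ h1 h2 =>
    rw [mul_add]
    exact (h1 hd hj).add (h2 hd hj)
  | smul hc _ h =>
    rw [mul_smul_comm]
    exact (h hd hj).smul hc

theorem FiniteParts.neg (h : FiniteParts ν f) : FiniteParts ν (-f) :=
  ⟨h.2, by simpa using h.1⟩

theorem IntegralExists.add (hf : Measurable f) (hfe : IntegralExists ν f)
    (hg : FiniteParts ν g) : IntegralExists ν (f + g) := by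
  rcases hfe with h | h
  · exact Or.inl (lintegral_ofReal_add_ne_top hf h.ne hg.1).lt_top
  · exact Or.inr (lintegral_ofReal_neg_add_ne_top hf h.ne hg.2).lt_top

/-- A function of the cone is compared after subtraction of a polynomial of degree at most
`k - 1`, on which the measures agree: the rest is a monotone limit of elementary functions. -/
theorem extIntegral_le_of_mem_coneF (hI : I.OrdConnected) (hI' : I.Nontrivial) (hw : IsGauge w)
    (hk : 1 ≤ k) (hkn : k ≤ n + 1)
    (heq : ∀ p ∈ polyLE w (k - 1), IntegralEqReal ν₁ ν₂ p)
    (hpoly : ∀ p ∈ polyCone w k n, Dominates ν₁ ν₂ p)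
    (htrunc : ∀ t, Dominates ν₁ ν₂ (pPlus w n t)) (hf : f ∈ coneF w k n)
    (h₁ : IntegralExists ν₁ f) (h₂ : IntegralExists ν₂ f) :
    extIntegral ν₂ f ≤ extIntegral ν₁ f := by
  obtain ⟨z, hz⟩ := hI'.nonempty
  obtain ⟨ε, g, T, hε, ⟨s, hs1, hs2, -, hs4⟩, hT, hfT⟩ :=
    coneF.exists_approx hI hI' hw hk hkn hf ⟨z, hz⟩ (k - 1) 0 n (by omega) (by omega)
  have hfm : Measurable f := dom_subset (Nat.zero_le n) hf.1
  have hp := hT.mem_polyCone hI hI' hw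
  have hpm : Measurable (w 0 * T) := dom_subset (Nat.zero_le _) hp.2.1
  obtain ⟨he1, he2, c, hc1, hc2⟩ := heq _ hp.1
  have hF1 := FiniteParts.of_eq_coe he1 hc1
  have hF2 := FiniteParts.of_eq_coe he2 hc2
  have e : f = w 0 * g + w 0 * T := by rw [← mul_add, ← hfT, gDeriv_zero_mul hw]
  have e' : w 0 * g = f + -(w 0 * T) := by rw [e, add_neg_cancel_right]
  have hgm : Measurable (w 0 * g) := by
    rw [e']
    exact hfm.add hpm.neg
  have hg1 : IntegralExists ν₁ (w 0 * g) := by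
    rw [e']
    exact h₁.add hfm hF1.neg
  have hg2 : IntegralExists ν₂ (w 0 * g) := by
    rw [e']
    exact h₂.add hfm hF2.neg
  have hdom := fun m => (hs1 m).dominates hI hI' hw hpoly htrunc rfl rfl
  have hle : extIntegral ν₂ (w 0 * g) ≤ extIntegral ν₁ (w 0 * g) :=
    extIntegral_le_of_tendsto (s := fun m => w 0 * s m) (fun m => (hdom m).1)
      (fun x => (SignedLE.monotone_ofReal hε hs2 (hw.pos 0 x).le x).1)
      (fun x => (SignedLE.monotone_ofReal hε hs2 (hw.pos 0 x).le x).2)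
      (fun x => (hs4 x).const_mul _) hg1 hg2 fun m => (hdom m).extIntegral_le
  rw [e, extIntegral_add hgm hpm hg1 hF1, extIntegral_add hgm hpm hg2 hF2, hc1, hc2]
  exact add_le_add_left hle _

theorem extIntegral_neg (h : FiniteParts ν f) : extIntegral ν (-f) = -extIntegral ν f := by
  simp only [extIntegral, Pi.neg_apply, neg_neg]
  rw [EReal.neg_sub (Or.inl (EReal.coe_ennreal_ne_bot _)) (Or.inl (by simpa using h.1)),
    sub_eq_add_neg, add_comm]

end

end GaugedCone

end

theorem mainTheorem1 (I : Set ℝ) (hI : I.OrdConnected) (hI_nontrivial : I.Nontrivial)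
    (w : ℕ → I → ℝ) (hw : GaugedCone.IsGauge w)
    (k n : ℕ) (hk : 1 ≤ k) (hkn : k ≤ n + 1)
    (G : Set (I → ℝ))
    (hG_lower : GaugedCone.polyCone w k n ∪ Set.range (GaugedCone.pPlus w n) ⊆ G)
    (hG_upper : G ⊆ GaugedCone.coneF w k n)
    (ν₁ ν₂ : MeasureTheory.Measure I)
    (hν₁ : ν₁ ∈ GaugedCone.admissible G) (hν₂ : ν₂ ∈ GaugedCone.admissible G) :
    (ν₁, ν₂) ∈ GaugedCone.dualCone G ↔
      (∀ p ∈ GaugedCone.polyLE w (k - 1), GaugedCone.IntegralEqReal ν₁ ν₂ p) ∧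
      (∀ p ∈ GaugedCone.polyCone w k n, GaugedCone.IntegralGE ν₁ ν₂ p) ∧
      (∀ t : I, GaugedCone.IntegralGE ν₁ ν₂ (GaugedCone.pPlus w n t)) := by
  open GaugedCone in
  have hpG : ∀ p ∈ polyCone w k n, p ∈ G := fun p hp => hG_lower (Or.inl hp)
  have htG : ∀ t, pPlus w n t ∈ G := fun t => hG_lower (Or.inr ⟨t, rfl⟩)
  constructor
  · rintro ⟨-, -, h⟩
    refine ⟨fun p hp => ?_, fun p hp => h p (hpG p hp), fun t => h _ (htG t)⟩
    have hp1 : p ∈ G := by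
      have := hpG _ (smul_mem_polyCone_of_mem_polyLE hI hI_nontrivial hw hk hkn hp 1)
      rwa [one_smul] at this
    have hp2 : -p ∈ G := by
      have := hpG _ (smul_mem_polyCone_of_mem_polyLE hI hI_nontrivial hw hk hkn hp (-1))
      rwa [neg_one_smul] at this
    have hfin : ∀ ν ∈ admissible G, FiniteParts ν p := fun ν hν =>
      ⟨by simpa using lintegral_neg_ne_top_of_bot_lt (hν _ hp2),
        lintegral_neg_ne_top_of_bot_lt (hν _ hp1)⟩
    obtain ⟨c, hc⟩ := (hfin ν₁ hν₁).extIntegral_eq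
    refine ⟨(hν₁ p hp1).1, (hν₂ p hp1).1, c, hc, ?_⟩
    have hle := (h _ hp2).2.2
    rw [extIntegral_neg (hfin ν₁ hν₁), extIntegral_neg (hfin ν₂ hν₂), EReal.neg_le_neg_iff] at hle
    rw [← hc]
    exact le_antisymm (h p hp1).2.2 hle
  · rintro ⟨h1, h2, h3⟩
    have hdom : ∀ f ∈ G, IntegralGE ν₁ ν₂ f → Dominates ν₁ ν₂ f := fun f hf h =>
      Dominates.of_extIntegral_le (dom_subset (Nat.zero_le n) (hG_upper hf).1)
        (lintegral_neg_ne_top_of_bot_lt (hν₁ f hf)) (lintegral_neg_ne_top_of_bot_lt (hν₂ f hf))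
        h.2.2
    exact ⟨hν₁, hν₂, fun f hf => ⟨(hν₁ f hf).1, (hν₂ f hf).1,
      extIntegral_le_of_mem_coneF hI hI_nontrivial hw hk hkn h1
        (fun p hp => hdom p (hpG p hp) (h2 p hp)) (fun t => hdom _ (htG t) (h3 t))
        (hG_upper hf) (hν₁ f hf).1 (hν₂ f hf).1⟩⟩
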